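/- **Conventions.** Let $\Delta,\mathcal C$ be disjoint sets of broadcast and binary channels, and $Act=\{\delta!,\delta?\mid\delta\in\Delta\}\cup\{c!,c?\mid c\in\mathcal C\}\cup\{\tau\}\cup\mathbb R_{\ge0}$. Variables are typed; some of them are clocks, with domain $\mathbb R_{\ge 0}$. $Val(V)$ is the set of type-respecting valuations of a set $V$ of variables; $v\oplus d$ increases all clocks of $v$ by $d$. For functions $f,g$: $f\lceil Z$ is the restriction to $Z$; $f\heartsuit g$ means that $f,g$ agree on $dom f\cap dom g$; $f\rhd g$ is defined on $dom f\cup dom g$ as $f$ on $dom f$ and $g$ elsewhere; $f\lhd g=g\rhd f$; $f\|g=f\rhd g$ if $f\heartsuit g$; $f[g]=(f\lhd g)\lceil dom f$. For $P\subseteq Val(V)$ and $v$ defined on a superset of $V$, $v\models P$ means $v\lceil V\in P$; $P$ does not depend on $Z\subseteq V$ if $v\models P\Leftrightarrow v[u]\models P$ for all $v\in Val(V)$, $u\in Val(Z)$. An LTS is a set of states with an initial state and a transition relation contained in $S\times Act\times S$. **Timed automata.** A timed automaton $\mathcal A=\langle L,K,l^0,E,H,v^0,I,\to,\to^u\rangle$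 has locations $L$, committed locations $K\subseteq L$, an initial location $l^0$, disjoint sets $E,H$ of external and internal variables ($V=E\cup H$), an initial valuation $v^0\in Val(V)$, invariants $I(l)\subseteq Val(V)$ that are left-closed ($v\oplus d\in I(l)\Rightarrow v\in I(l)$) with $v^0\in I(l^0)$, transitions $l\xrightarrow{g,a,\rho}l'$ with $a\in Act\setminus\mathbb R_{\ge0}$, $\rho:Val(V)\to Val(V)$ and guard $g\subseteq Val(V)$ a conjunction of comparisons of clocks and of differences of clocks with constants and of a condition not depending on clocks, and a subset $\to^u$ of urgent transitions. For a state $s$ defined on a superset of $V$, $\rho(s)=s[\rho(s\lceil V)]$. A network $\mathcal N=\langle\mathcal A_1,\dots,\mathcal A_n\rangle$, $n\ge1$, consists of timed automata with $H_i\cap V_j=\emptyset$ and $v^0_i\heartsuit v^0_j$ for $i\ne j$. Let $\mathsf{loc}_i$ be pairwise distinct fresh non-clock variables of type $L_i$, and $W_i=V_i\cup\{\mathsf{loc}_i\}$. **Non-compositional semantics.** $\mathsf{LTS}(\mathcal N)$ has the states $S=\{v\in Val(\bigcup_iW_i)\mid\forall i: v\models I_i(v(\mathsf{loc}_i))\}$,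 the initial state $v_1^0\|\cdots\|v_n^0\|\{\mathsf{loc}_i\mapsto l_i^0\}_i$, and the following transitions between states $s,s'\in S$. Let $nc(s)$ mean $s(\mathsf{loc}_k)\notin K_k$ for all $k$, and let $RS(\delta,i,s)$ be the set of all $j\ne i$ for which $\mathcal A_j$ has a transition $s(\mathsf{loc}_j)\xrightarrow{g,\delta?,\rho}l'$ with $s\models g$. * TAU: $s\xrightarrow{\tau}\rho(s)[\mathsf{loc}_i\mapsto l']$ if $l\xrightarrow{g,\tau,\rho}_il'$, $s(\mathsf{loc}_i)=l$, $s\models g$, and $nc(s)$ or $l\in K_i$. * SYNC: $s\xrightarrow{\tau}\rho_j(\rho_i(s))[\mathsf{loc}_i\mapsto l_i',\mathsf{loc}_j\mapsto l_j']$ if $i\neq j$, $l_i\xrightarrow{g_i,c!,\rho_i}_il_i'$, $l_j\xrightarrow{g_j,c?,\rho_j}_jl_j'$, $s(\mathsf{loc}_i)=l_i$, $s(\mathsf{loc}_j)=l_j$, $s\models g_i$, $s\models g_j$, and $nc(s)$ or $l_i\in K_i$ or $l_j\in K_j$. * TIME: $s\xrightarrow{d}s\oplus d$ if $nc(s)$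 and there is no urgent $\tau$-transition of any $\mathcal A_i$ from $s(\mathsf{loc}_i)$ whose guard holds in $s$. * BCST: if $l_i\xrightarrow{g_i,\delta!,\rho_i}_il_i'$, $s(\mathsf{loc}_i)=l_i$, $s\models g_i$, and for every $j\in RS(\delta,i,s)=\{j_1<\dots<j_m\}$ a transition $l_j\xrightarrow{g_j,\delta?,\rho_j}_jl_j'$ with $s(\mathsf{loc}_j)=l_j$, $s\models g_j$ is chosen, and $nc(s)$ or $l_i\in K_i$ or $l_j\in K_j$ for some $j\in RS(\delta,i,s)$, then $s\xrightarrow{\tau}\rho_{j_m}(\cdots\rho_{j_1}(\rho_i(s)))[\mathsf{loc}_i\mapsto l_i',\mathsf{loc}_{j_1}\mapsto l_{j_1}',\dots,\mathsf{loc}_{j_m}\mapsto l'_{j_m}]$. **Compositional semantics.** A TTSB $\langle E,H,S,s^0,Act,\to^1,\to^0\rangle$ has committed ($\xrightarrow{a,1}$) and uncommitted ($\xrightarrow{a,0}$) transitions; $Comm(s)$ means that some committed transition starts in $s$; $\mathsf{LTS}(\mathcal T)$ has the states of $\mathcal T$ and the transitions $\to^1\cup\to^0$. $\mathsf{TTSB}(\mathcal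 A)$ has external variables $E$, internal variables $H\cup\{\mathsf{loc}\}$, states $\{v\in Val(V\cup\{\mathsf{loc}\})\mid v\models I(v(\mathsf{loc}))\}$, initial state $v^0\|\{\mathsf{loc}\mapsto l^0\}$, and the following transitions between its states: * ACT: $s\xrightarrow{a,b}\rho(s)[\mathsf{loc}\mapsto l']$ if $l\xrightarrow{g,a,\rho}l'$, $s(\mathsf{loc})=l$, $s\models g$, where $b\Leftrightarrow l\in K$. * TIME: $s\xrightarrow{d,0}s\oplus d$ if $s(\mathsf{loc})\notin K$ and no urgent $\tau$-transition from $s(\mathsf{loc})$ has a guard that holds in $s$. * VIRT: $s\xrightarrow{\delta?,0}s$ if no $\delta?$-transition from $s(\mathsf{loc})$ has a guard that holds in $s$. $\mathcal T_1\|\mathcal T_2$ has external variables $E_1\cup E_2$, internal variables $H_1\cup H_2$, states $r\|s$ with $r\in S_1,s\in S_2,r\heartsuit s$, initial state $s_1^0\|s_2^0$, and for $\{i,j\}=\{1,2\}$, $r\in S_i$, $s\in S_j$, $r\heartsuit s$ the transitions * EXT: $r\|s\xrightarrow{a,b}r'\rhd s$ if $a\in\{c!,c?\mid c\in\mathcal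 C\}$ and $r\xrightarrow{a,b}_ir'$; * TAU: $r\|s\xrightarrow{\tau,b}r'\rhd s$ if $r\xrightarrow{\tau,b}_ir'$ and $Comm(s)\Rightarrow b$; * SYNC: $r\|s\xrightarrow{\tau,b\vee b'}r'\lhd s'$ if $r\xrightarrow{c!,b}_ir'$, $s[r']\xrightarrow{c?,b'}_js'$ and $Comm(r)\vee Comm(s)\Rightarrow b\vee b'$; * TIME: $r\|s\xrightarrow{d,0}r'\|s'$ if $r\xrightarrow{d,0}_ir'$, $s\xrightarrow{d,0}_js'$; * SND: $r\|s\xrightarrow{\delta!,b\vee b'}r'\|s'$ if $r\xrightarrow{\delta!,b}_ir'$, $s[r']\xrightarrow{\delta?,b'}_js'$; * RCV: $r\|s\xrightarrow{\delta?,b\vee b'}r'\|s'$ if $r\xrightarrow{\delta?,b}_ir'$, $s\xrightarrow{\delta?,b'}_js'$. $\mathcal T\backslash(\Delta\cup\mathcal C)$ arises from $\mathcal T$ by removing all transitions labeled $\delta?$, $c!$, $c?$, removing every $s\xrightarrow{\delta!,b}s'$ with $Comm(s)\wedge\neg b$, and replacing every other $s\xrightarrow{\delta!,b}s'$ by $s\xrightarrow{\tau,b}s'$.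 The composition of $n$ TTSBs is bracketed to the left. **Theorem.** Let $\mathcal N=\langle\mathcal A_1,\dots,\mathcal A_n\rangle$ be a network of timed automata such that every $\mathcal A=\mathcal A_i$ satisfies: * (VII) $I(l)$ does not depend on $E$, for every $l$; * (VIII) if $l\xrightarrow{g,\sigma?,\rho}l'$ with $\sigma\in\Delta\cup\mathcal C$, then $g$ does not depend on $E$; * (IX) for all $l\in K$ and $v\in I(l)$ there is $l\xrightarrow{g,a,\rho}l'$ with $v\in g$ and $\rho(v)\in I(l')$; * (X) urgent transitions have action $\tau$ and a guard that does not depend on clocks; * (XI) if $l\xrightarrow{g,\delta?,\rho}l'$ with $\delta\in\Delta$, then $\rho(v)\lceil E=v\lceil E$ for all $v\in Val(V)$; * (broadcast inputs lead to legal states) if $v\in I(l)$ and the guard of some $\delta?$-transition from $l$ holds in $v$, then some $l\xrightarrow{g,\delta?,\rho}l'$ satisfies $v\in g$ and $\rho(v)\in I(l')$. Then $$\mathsf{LTS}(\mathcal N)\;\cong\;\mathsf{LTS}\bigl((\mathsf{TTSB}(\mathcal A_1)\|\cdots\|\mathsf{TTSB}(\mathcal A_n))\backslash(\Delta\cup\mathcal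 C)\bigr),$$ i.e. there is a bijection between the states that maps the initial state to the initial state and preserves and reflects all transitions. -/

import Mathlib

open scoped NNReal

noncomputable section

namespace BroadcastTA

/-! ### Typed variables and partial valuations -/

/-- The universal set of variables: clocks `x : X` and all other variables `y : Y`. -/
inductive Var (X Y : Type*) where
  | clock (x : X)
  | data (y : Y)

/-- Domains of the variables: `ℝ≥0` for a clock, `D y` for any other variable `y`. -/
abbrev Var.Dom {X Y : Type*} (D : Y → Type) : Var X Y → Type
  | .clock _ => ℝ≥0
  | .data y => D y

/-- The set of all clocks. -/
def clocks (X Y : Type*) : Set (Var X Y) := Set.range Var.clock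

/-- Functions whose domain is a set of variables and which respect the types; `none` means
that the variable is not in the domain. -/
abbrev PVal (X : Type*) {Y : Type*} (D : Y → Type) := (x : Var X Y) → Option (x.Dom D)

namespace PVal

variable {X Y : Type*} {D : Y → Type}

/-- The domain `dom f`. -/
def dom (f : PVal X D) : Set (Var X Y) := {x | (f x).isSome}

/-- The function with empty domain. -/
def empty : PVal X D := fun _ => none

open Classical in
/-- The restriction `f⌈Z`. -/
def restrict (f : PVal X D) (Z : Set (Var X Y)) : PVal X D :=
  fun x => if x ∈ Z then f x else none

/-- The override `f ▷ g`, which prefers `f`. On compatible functions it is the merge `f ‖ g`. -/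
def override (f g : PVal X D) : PVal X D := fun x => (f x).or (g x)

/-- Compatibility `f ♡ g`. -/
def Compat (f g : PVal X D) : Prop := ∀ x ∈ f.dom ∩ g.dom, f x = g x

/-- The update `f[g] = (g ▷ f)⌈dom f`. -/
def update (f g : PVal X D) : PVal X D := (g.override f).restrict f.dom

open Classical in
/-- The valuation `{y ↦ a}`. -/
def single (y : Y) (a : D y) : PVal X D
  | .clock _ => none
  | .data z => if h : y = z then some (h ▸ a) else none

/-- `v ⊕ d`: every clock in the domain is increased by `d`. -/
def delay (v : PVal X D) (d : ℝ≥0) : PVal X D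
  | .clock x => Option.map (fun t : ℝ≥0 => t + d) (v (.clock x))
  | .data y => v (.data y)

/-- `f_0 ‖ ⋯ ‖ f_n` (for pairwise compatible functions). -/
def mergeAll : {n : ℕ} → (Fin (n + 1) → PVal X D) → PVal X D
  | 0, f => f 0
  | _ + 1, f => (mergeAll fun i => f i.castSucc).override (f (Fin.last _))

end PVal

section Properties

variable {X Y : Type*} {D : Y → Type}

/-- The set of valuations for `V`. -/
def Val (V : Set (Var X Y)) : Set (PVal X D) := {v | v.dom = V}

/-- A property `P` over `V` is left-closed. -/
def LeftClosed (V : Set (Var X Y)) (P : Set (PVal X D)) : Prop :=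
  ∀ v ∈ (Val V : Set (PVal X D)), ∀ d : ℝ≥0, v.delay d ∈ P → v ∈ P

/-- A property `P` over `V` does not depend on the variables in `W ⊆ V`. -/
def NotDependOn (V W : Set (Var X Y)) (P : Set (PVal X D)) : Prop :=
  ∀ v ∈ (Val V : Set (PVal X D)), ∀ u ∈ (Val W : Set (PVal X D)), v ∈ P ↔ v.update u ∈ P

/-- The property `P` over `V` holds in `v`, for `v` defined on a superset of `V`. -/
def Holds (V : Set (Var X Y)) (P : Set (PVal X D)) (v : PVal X D) : Prop := v.restrict V ∈ P

/-- Comparison operators. -/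
inductive Cmp where
  | lt | le | eq | ge | gt

/-- The relation on the reals denoted by a comparison operator. -/
def Cmp.rel : Cmp → ℝ → ℝ → Prop
  | .lt, a, b => a < b
  | .le, a, b => a ≤ b
  | .eq, a, b => a = b
  | .ge, a, b => a ≥ b
  | .gt, a, b => a > b

/-- Simple conditions `x ⋈ k` on clocks and `x - y ⋈ k` on differences between clocks. -/
inductive ClockCond (X : Type*) where
  | single (x : X) (c : Cmp) (k : ℝ)
  | diff (x y : X) (c : Cmp) (k : ℝ)

/-- Satisfaction of a clock condition (false if one of its clocks has no value). -/
def ClockCond.Sat : ClockCond X → PVal X D → Prop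
  | .single x c k, v => ∃ s : ℝ≥0, v (.clock x) = some s ∧ c.rel s k
  | .diff x y c k, v =>
      ∃ s t : ℝ≥0, v (.clock x) = some s ∧ v (.clock y) = some t ∧ c.rel ((s : ℝ) - t) k

/-- `g` is a guard over `V`: a conjunction of simple conditions on clocks and clock differences
and of a condition `B` that does not involve clocks. -/
def IsGuard (V : Set (Var X Y)) (g : Set (PVal X D)) : Prop :=
  ∃ (cs : List (ClockCond X)) (B : Set (PVal X D)),
    NotDependOn V (V ∩ clocks X Y) B ∧
    g = {v | v ∈ (Val V : Set (PVal X D)) ∧ (∀ c ∈ cs, c.Sat v) ∧ v ∈ B}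

end Properties

/-! ### Actions and labeled transition systems -/

/-- The actions `δ!`, `δ?` (broadcast channels `δ : Δ`), `c!`, `c?` (binary channels `c : C`)
and the internal action `τ`. -/
inductive DAct (Δ C : Type*) where
  | bsend (δ : Δ)
  | brecv (δ : Δ)
  | csend (c : C)
  | crecv (c : C)
  | tau

/-- The action set `Act`: the actions above and the time-passage actions `d ∈ ℝ≥0`. -/
inductive Act (Δ C : Type*) where
  | disc (a : DAct Δ C)
  | delay (d : ℝ≥0)

/-- Labeled transition systems with action set `A`. -/
structure LTS (A : Type*) where
  State : Type*
  init : State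
  tr : State → A → State → Prop

/-- Isomorphisms of labeled transition systems. -/
structure LTS.Iso {A : Type*} (L₁ L₂ : LTS A) where
  toEquiv : L₁.State ≃ L₂.State
  map_init : toEquiv L₁.init = L₂.init
  map_tr : ∀ s a t, L₁.tr s a t ↔ L₂.tr (toEquiv s) a (toEquiv t)

/-! ### Timed automata -/

/-- Timed automata. The set of locations `L` is the domain `D loc` of a variable `loc` that is
fresh, i.e. does not occur among the external and internal variables. -/
structure TA (X : Type*) {Y : Type*} (D : Y → Type) (Δ C : Type*) where
  /-- the fresh location variable, with type `L = D loc` -/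
  loc : Y
  /-- the committed locations -/
  K : Set (D loc)
  /-- the initial location -/
  l0 : D loc
  /-- the external variables -/
  E : Set (Var X Y)
  /-- the internal variables -/
  H : Set (Var X Y)
  disjoint_EH : Disjoint E H
  loc_fresh : Var.data loc ∉ E ∪ H
  /-- the initial valuation -/
  v0 : PVal X D
  v0_mem : v0 ∈ (Val (E ∪ H) : Set (PVal X D))
  /-- the location invariants -/
  I : D loc → Set (PVal X D)
  I_subset : ∀ l, I l ⊆ Val (E ∪ H)
  I_leftClosed : ∀ l, LeftClosed (E ∪ H) (I l)
  v0_inv : v0 ∈ I l0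
  /-- `tr l g a ρ l'` is the transition from `l` to `l'` with guard `g`, action `a` and
  update function `ρ` -/
  tr : D loc → Set (PVal X D) → DAct Δ C → (PVal X D → PVal X D) → D loc → Prop
  tr_guard : ∀ {l g a ρ l'}, tr l g a ρ l' → IsGuard (E ∪ H) g
  tr_update : ∀ {l g a ρ l'}, tr l g a ρ l' →
    Set.MapsTo ρ (Val (E ∪ H) : Set (PVal X D)) (Val (E ∪ H) : Set (PVal X D))
  /-- the urgent transitions -/
  urgent : D loc → Set (PVal X D) → DAct Δ C → (PVal X D → PVal X D) → D loc → Prop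
  urgent_tr : ∀ {l g a ρ l'}, urgent l g a ρ l' → tr l g a ρ l'

namespace TA

variable {X Y : Type*} {D : Y → Type} {Δ C : Type*}

/-- `V = E ∪ H`. -/
def V (A : TA X D Δ C) : Set (Var X Y) := A.E ∪ A.H

/-- `W = E ∪ H ∪ {loc}`. -/
def W (A : TA X D Δ C) : Set (Var X Y) := A.E ∪ A.H ∪ {Var.data A.loc}

/-- `s(loc) = l`. -/
def At (A : TA X D Δ C) (s : PVal X D) (l : D A.loc) : Prop := s (Var.data A.loc) = some l

/-- `s(loc) ∈ K`. -/
def InCommitted (A : TA X D Δ C) (s : PVal X D) : Prop := ∃ l ∈ A.K, A.At s l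

/-- An update function `ρ` of `A`, applied to a state `s` that is defined on a superset of
`V`: `ρ(s) = s[ρ(s⌈V)]`. -/
def apply (A : TA X D Δ C) (ρ : PVal X D → PVal X D) (s : PVal X D) : PVal X D :=
  s.update (ρ (s.restrict A.V))

/-- The location part `{loc ↦ l}`. -/
def locVal (A : TA X D Δ C) (l : D A.loc) : PVal X D := PVal.single A.loc l

/-- Compatibility of timed automata; the last three conditions express that the location
variable of one automaton is fresh also with respect to the other automaton. -/
structure Compatible (A B : TA X D Δ C) : Prop where
  left : A.H ∩ B.V = ∅
  right : B.H ∩ A.V = ∅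
  init : A.v0.Compat B.v0
  loc_ne : A.loc ≠ B.loc
  loc_left : Var.data A.loc ∉ B.V
  loc_right : Var.data B.loc ∉ A.V

/-- The axioms imposed on timed automata. -/
structure Axioms (A : TA X D Δ C) : Prop where
  /-- invariants do not depend on external variables -/
  inv : ∀ l, NotDependOn A.V A.E (A.I l)
  /-- guards of input transitions do not depend on external variables -/
  input_guard : ∀ {l g a ρ l'}, A.tr l g a ρ l' →
    ((∃ δ, a = .brecv δ) ∨ ∃ c, a = .crecv c) → NotDependOn A.V A.E g
  /-- some transition is possible whenever the automaton is in a committed location -/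
  committed : ∀ l ∈ A.K, ∀ v ∈ A.I l, ∃ g a ρ l', A.tr l g a ρ l' ∧ v ∈ g ∧ ρ v ∈ A.I l'
  /-- urgent transitions are internal and have no clock guards -/
  urgent : ∀ {l g a ρ l'}, A.urgent l g a ρ l' →
    a = .tau ∧ NotDependOn A.V (A.V ∩ clocks X Y) g
  /-- broadcast input transitions do not update external variables -/
  recv_update : ∀ {l g δ ρ l'}, A.tr l g (.brecv δ) ρ l' →
    ∀ v ∈ (Val A.V : Set (PVal X D)), (ρ v).restrict A.E = v.restrict A.E

/-- Broadcast inputs lead to legal states (which makes `TTSB(A)` input-enabled for broadcast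
actions): if the guard of some `δ?`-transition holds in a legal state, then at least one `δ?`-transition
whose guard holds leads to a legal state. -/
def Receptive (A : TA X D Δ C) : Prop :=
  ∀ l, ∀ v ∈ A.I l, ∀ δ, (∃ g ρ l', A.tr l g (.brecv δ) ρ l' ∧ v ∈ g) →
    ∃ g ρ l', A.tr l g (.brecv δ) ρ l' ∧ v ∈ g ∧ ρ v ∈ A.I l'

end TA

/-! ### Timed transition systems with broadcast actions -/

/-- The tuples `⟨E, H, S, s⁰, Act, →¹, →⁰⟩`; `tr b` is the relation `→ᵇ`. The structure carries
only the data: it is used for the concrete tuples built below, and restriction by broadcast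
channels does not preserve input-enabledness. -/
structure TTSB (X : Type*) {Y : Type*} (D : Y → Type) (Δ C : Type*) where
  E : Set (Var X Y)
  H : Set (Var X Y)
  S : Set (PVal X D)
  s0 : PVal X D
  tr : Bool → PVal X D → Act Δ C → PVal X D → Prop

namespace TTSB

variable {X Y : Type*} {D : Y → Type} {Δ C : Type*}

/-- `s` is a committed state. -/
def Comm (T : TTSB X D Δ C) (s : PVal X D) : Prop := ∃ a t, T.tr true s a t

/-- The transitions of a parallel composition, with `T₁` in the role of component `i` and `T₂`
in the role of component `j` of the rules. -/
inductive ParStep (T₁ T₂ : TTSB X D Δ C) : Bool → PVal X D → Act Δ C → PVal X D → Prop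
  | ext {r s r' : PVal X D} {b : Bool} {a : DAct Δ C} :
      r ∈ T₁.S → s ∈ T₂.S → r.Compat s →
      ((∃ c, a = .csend c) ∨ ∃ c, a = .crecv c) →
      T₁.tr b r (.disc a) r' →
      ParStep T₁ T₂ b (r.override s) (.disc a) (r'.override s)
  | tau {r s r' : PVal X D} {b : Bool} :
      r ∈ T₁.S → s ∈ T₂.S → r.Compat s →
      T₁.tr b r (.disc .tau) r' → (T₂.Comm s → b = true) →
      ParStep T₁ T₂ b (r.override s) (.disc .tau) (r'.override s)
  | sync {r s r' s' : PVal X D} {b b' : Bool} {c : C} :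
      r ∈ T₁.S → s ∈ T₂.S → r.Compat s →
      T₁.tr b r (.disc (.csend c)) r' → T₂.tr b' (s.update r') (.disc (.crecv c)) s' →
      (T₁.Comm r ∨ T₂.Comm s → (b || b') = true) →
      ParStep T₁ T₂ (b || b') (r.override s) (.disc .tau) (s'.override r')
  | time {r s r' s' : PVal X D} {d : ℝ≥0} :
      r ∈ T₁.S → s ∈ T₂.S → r.Compat s →
      T₁.tr false r (.delay d) r' → T₂.tr false s (.delay d) s' → r'.Compat s' →
      ParStep T₁ T₂ false (r.override s) (.delay d) (r'.override s')
  | snd {r s r' s' : PVal X D} {b b' : Bool} {δ : Δ} :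
      r ∈ T₁.S → s ∈ T₂.S → r.Compat s →
      T₁.tr b r (.disc (.bsend δ)) r' → T₂.tr b' (s.update r') (.disc (.brecv δ)) s' →
      r'.Compat s' →
      ParStep T₁ T₂ (b || b') (r.override s) (.disc (.bsend δ)) (r'.override s')
  | rcv {r s r' s' : PVal X D} {b b' : Bool} {δ : Δ} :
      r ∈ T₁.S → s ∈ T₂.S → r.Compat s →
      T₁.tr b r (.disc (.brecv δ)) r' → T₂.tr b' s (.disc (.brecv δ)) s' →
      r'.Compat s' →
      ParStep T₁ T₂ (b || b') (r.override s) (.disc (.brecv δ)) (r'.override s')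

/-- The parallel composition `T₁ ‖ T₂` (used for compatible `T₁`, `T₂` only). -/
def par (T₁ T₂ : TTSB X D Δ C) : TTSB X D Δ C where
  E := T₁.E ∪ T₂.E
  H := T₁.H ∪ T₂.H
  S := {v | ∃ r ∈ T₁.S, ∃ s ∈ T₂.S, r.Compat s ∧ v = r.override s}
  s0 := T₁.s0.override T₂.s0
  tr := fun b u a u' => ParStep T₁ T₂ b u a u' ∨ ParStep T₂ T₁ b u a u'

/-- `T_0 ‖ ⋯ ‖ T_n`, bracketed to the left. -/
def parAll : {n : ℕ} → (Fin (n + 1) → TTSB X D Δ C) → TTSB X D Δ C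
  | 0, T => T 0
  | _ + 1, T => (parAll fun i => T i.castSucc).par (T (Fin.last _))

/-- The transitions of the restriction by the broadcast channels in `B` and the binary channels
in `F`: a transition that is kept, or a `τ`-transition that replaces a `δ!`-transition. -/
inductive RestrictStep (T : TTSB X D Δ C) (B : Set Δ) (F : Set C) :
    Bool → PVal X D → Act Δ C → PVal X D → Prop
  | keep {s t : PVal X D} {b : Bool} {a : Act Δ C} :
      T.tr b s a t →
      (∀ δ ∈ B, a ≠ .disc (.bsend δ) ∧ a ≠ .disc (.brecv δ)) →
      (∀ c ∈ F, a ≠ .disc (.csend c) ∧ a ≠ .disc (.crecv c)) →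
      RestrictStep T B F b s a t
  | hide {s t : PVal X D} {b : Bool} {δ : Δ} :
      δ ∈ B → T.tr b s (.disc (.bsend δ)) t → (T.Comm s → b = true) →
      RestrictStep T B F b s (.disc .tau) t

/-- The restriction of `T` by the set `B ∪ F ∪ Z` of broadcast channels, binary channels and
external variables (`Z ⊆ E`). -/
def restrict (T : TTSB X D Δ C) (B : Set Δ) (F : Set C) (Z : Set (Var X Y)) :
    TTSB X D Δ C where
  E := T.E \ Z
  H := T.H ∪ (T.E ∩ Z)
  S := T.S
  s0 := T.s0
  tr := RestrictStep T B F

/-- The underlying labeled transition system `LTS(T)`. -/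
def lts (T : TTSB X D Δ C) (h : T.s0 ∈ T.S) : LTS (Act Δ C) where
  State := T.S
  init := ⟨T.s0, h⟩
  tr := fun s a t => T.tr true s a t ∨ T.tr false s a t

end TTSB

/-! ### The TTSB of a timed automaton -/

namespace TA

variable {X Y : Type*} {D : Y → Type} {Δ C : Type*}

/-- The states of the TTSB associated to `A`. -/
def states (A : TA X D Δ C) : Set (PVal X D) :=
  {v | v ∈ (Val A.W : Set (PVal X D)) ∧ ∃ l, A.At v l ∧ Holds A.V (A.I l) v}

/-- The transitions of the TTSB associated to `A`. -/
inductive Step (A : TA X D Δ C) : Bool → PVal X D → Act Δ C → PVal X D → Prop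
  | act {s s' : PVal X D} {l g a ρ l'} {b : Bool} :
      s ∈ A.states → s' ∈ A.states →
      A.tr l g a ρ l' → A.At s l → Holds A.V g s →
      s' = (A.apply ρ s).update (A.locVal l') → (b = true ↔ l ∈ A.K) →
      Step A b s (.disc a) s'
  | time {s s' : PVal X D} {d : ℝ≥0} :
      s ∈ A.states → s' ∈ A.states →
      s' = s.delay d → ¬ A.InCommitted s →
      (¬ ∃ l g ρ l', A.urgent l g .tau ρ l' ∧ A.At s l ∧ Holds A.V g s) →
      Step A false s (.delay d) s'
  | virt {s : PVal X D} {δ : Δ} :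
      s ∈ A.states →
      (¬ ∃ l g ρ l', A.tr l g (.brecv δ) ρ l' ∧ A.At s l ∧ Holds A.V g s) →
      Step A false s (.disc (.brecv δ)) s

/-- `TTSB(A)`. -/
def ttsb (A : TA X D Δ C) : TTSB X D Δ C where
  E := A.E
  H := A.H ∪ {Var.data A.loc}
  S := A.states
  s0 := A.v0.override (A.locVal A.l0)
  tr := A.Step

end TA

/-! ### Networks of timed automata -/

/-- Networks `⟨A_0, …, A_n⟩` of pairwise compatible timed automata. -/
structure NTA (X : Type*) {Y : Type*} (D : Y → Type) (Δ C : Type*) (n : ℕ) where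
  A : Fin (n + 1) → TA X D Δ C
  compat : ∀ i j, i ≠ j → (A i).Compatible (A j)

namespace NTA

variable {X Y : Type*} {D : Y → Type} {Δ C : Type*} {n : ℕ}

/-- The states of `LTS(N)`. -/
def states (N : NTA X D Δ C n) : Set (PVal X D) :=
  {v | v ∈ (Val (⋃ i, (N.A i).W) : Set (PVal X D)) ∧
    ∀ i, ∃ l, (N.A i).At v l ∧ Holds (N.A i).V ((N.A i).I l) v}

/-- The initial state of `LTS(N)`. -/
def s0 (N : NTA X D Δ C n) : PVal X D :=
  (PVal.mergeAll fun i => (N.A i).v0).override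
    (PVal.mergeAll fun i => (N.A i).locVal (N.A i).l0)

/-- `RS(δ, i, s)`: the automata other than `A i` with an executable `δ?`-transition. -/
def RS (N : NTA X D Δ C n) (δ : Δ) (i : Fin (n + 1)) (s : PVal X D) : Set (Fin (n + 1)) :=
  {j | i ≠ j ∧ ∃ l g ρ l', (N.A j).tr l g (.brecv δ) ρ l' ∧ (N.A j).At s l ∧
    Holds (N.A j).V g s}

open Classical in
/-- `RS(δ, i, s)` enumerated as `j_1, …, j_m` in the order of the network. -/
def RSlist (N : NTA X D Δ C n) (δ : Δ) (i : Fin (n + 1)) (s : PVal X D) : List (Fin (n + 1)) :=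
  (List.finRange (n + 1)).filter fun j => j ∈ N.RS δ i s

/-- No automaton is in a committed location. -/
def NoCommitted (N : NTA X D Δ C n) (s : PVal X D) : Prop := ∀ k, ¬ (N.A k).InCommitted s

/-- The rules for the transitions of `LTS(N)`. In the rule for broadcasts, `l k`, `g k`, `ρ k`,
`l' k` describe the chosen transition of `A k`; they matter only for `k = i` and
`k ∈ RS(δ, i, s)`. -/
inductive Step (N : NTA X D Δ C n) : PVal X D → Act Δ C → PVal X D → Prop
  | tau {s s' : PVal X D} {i l g ρ l'} :
      (N.A i).tr l g .tau ρ l' → (N.A i).At s l → Holds (N.A i).V g s →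
      s' = ((N.A i).apply ρ s).update ((N.A i).locVal l') →
      (N.NoCommitted s ∨ l ∈ (N.A i).K) →
      Step N s (.disc .tau) s'
  | sync {s s' : PVal X D} {c : C} {i j li gi ρi li' lj gj ρj lj'} :
      i ≠ j →
      (N.A i).tr li gi (.csend c) ρi li' → (N.A i).At s li → Holds (N.A i).V gi s →
      (N.A j).tr lj gj (.crecv c) ρj lj' → (N.A j).At s lj → Holds (N.A j).V gj s →
      s' = ((N.A j).apply ρj ((N.A i).apply ρi s)).update
        (((N.A i).locVal li').override ((N.A j).locVal lj')) →
      (N.NoCommitted s ∨ li ∈ (N.A i).K ∨ lj ∈ (N.A j).K) →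
      Step N s (.disc .tau) s'
  | time {s s' : PVal X D} {d : ℝ≥0} :
      s' = s.delay d → N.NoCommitted s →
      (¬ ∃ i l g ρ l', (N.A i).urgent l g .tau ρ l' ∧ (N.A i).At s l ∧ Holds (N.A i).V g s) →
      Step N s (.delay d) s'
  | bcst {s s' : PVal X D} {δ : Δ} {i : Fin (n + 1)}
      {l l' : ∀ k, D (N.A k).loc} {g : Fin (n + 1) → Set (PVal X D)}
      {ρ : Fin (n + 1) → PVal X D → PVal X D} :
      (N.A i).tr (l i) (g i) (.bsend δ) (ρ i) (l' i) →
      (N.A i).At s (l i) → Holds (N.A i).V (g i) s →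
      (∀ j ∈ N.RS δ i s, (N.A j).tr (l j) (g j) (.brecv δ) (ρ j) (l' j) ∧
        (N.A j).At s (l j) ∧ Holds (N.A j).V (g j) s) →
      (N.NoCommitted s ∨ l i ∈ (N.A i).K ∨ ∃ j ∈ N.RS δ i s, l j ∈ (N.A j).K) →
      s' = ((N.RSlist δ i s).foldl (fun t j => (N.A j).apply (ρ j) t)
          ((N.A i).apply (ρ i) s)).update
        ((i :: N.RSlist δ i s).foldr (fun k f => ((N.A k).locVal (l' k)).override f)
          PVal.empty) →
      Step N s (.disc .tau) s'

/-- `(TTSB(A_0) ‖ ⋯ ‖ TTSB(A_n)) \ (Δ ∪ C)`. -/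
def ttsb (N : NTA X D Δ C n) : TTSB X D Δ C :=
  (TTSB.parAll fun i => (N.A i).ttsb).restrict Set.univ Set.univ ∅

end NTA

/-! ### The initial states are states -/

section Init

variable {X Y : Type*} {D : Y → Type} {Δ C : Type*} {n : ℕ}

theorem PVal.compat_iff {f g : PVal X D} :
    f.Compat g ↔ ∀ x a b, f x = some a → g x = some b → a = b := by
  constructor
  · intro h x a b ha hb
    have := h x ⟨by simp [PVal.dom, ha], by simp [PVal.dom, hb]⟩
    rw [ha, hb] at this
    exact Option.some.inj this
  · rintro h x ⟨h1, h2⟩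
    obtain ⟨a, ha⟩ := Option.isSome_iff_exists.1 h1
    obtain ⟨b, hb⟩ := Option.isSome_iff_exists.1 h2
    rw [ha, hb, h x a b ha hb]

theorem PVal.Compat.symm {f g : PVal X D} (h : f.Compat g) : g.Compat f :=
  fun x hx => (h x hx.symm).symm

theorem PVal.exists_of_mergeAll : ∀ {n : ℕ} {f : Fin (n + 1) → PVal X D} {x a},
    PVal.mergeAll f x = some a → ∃ i, f i x = some a
  | 0, f, x, a, h => ⟨0, h⟩
  | n + 1, f, x, a, h => by
    simp only [PVal.mergeAll, PVal.override, Option.or_eq_some_iff] at h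
    rcases h with h | ⟨-, h⟩
    · obtain ⟨i, hi⟩ := exists_of_mergeAll h
      exact ⟨_, hi⟩
    · exact ⟨_, h⟩

theorem PVal.mergeAll_of_some : ∀ {n : ℕ} {f : Fin (n + 1) → PVal X D},
    (∀ i j, (f i).Compat (f j)) → ∀ {i x a}, f i x = some a → PVal.mergeAll f x = some a
  | 0, f, _, i, x, a, h => by
    obtain rfl : i = 0 := Fin.fin_one_eq_zero i
    exact h
  | n + 1, f, hf, i, x, a, h => by
    simp only [PVal.mergeAll, PVal.override, Option.or_eq_some_iff]
    rcases hm : PVal.mergeAll (fun i => f i.castSucc) x with _ | b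
    · right
      refine ⟨rfl, ?_⟩
      induction i using Fin.lastCases with
      | last => exact h
      | cast i =>
        rw [mergeAll_of_some (fun i j => hf _ _) h] at hm
        cases hm
    · left
      obtain ⟨j, hj⟩ := exists_of_mergeAll hm
      rw [PVal.compat_iff.1 (hf _ _) x b a hj h]

theorem PVal.compat_refl (f : PVal X D) : f.Compat f := fun _ _ => rfl

theorem PVal.single_some {y : Y} {l : D y} {x : Var X Y} {a : x.Dom D} :
    (PVal.single y l : PVal X D) x = some a → x = Var.data y := by
  cases x with
  | clock x => exact fun h => nomatch h
  | data z =>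
    simp only [PVal.single]
    split
    · next h => exact fun _ => h ▸ rfl
    · simp

theorem PVal.single_self (y : Y) (l : D y) :
    (PVal.single y l : PVal X D) (Var.data y) = some l :=
  dif_pos rfl

theorem PVal.single_dom {y : Y} {l : D y} : (PVal.single y l : PVal X D).dom = {Var.data y} := by
  ext x
  constructor
  · intro h
    obtain ⟨a, ha⟩ := Option.isSome_iff_exists.1 h
    exact PVal.single_some ha
  · rintro rfl
    exact Option.isSome_iff_exists.2 ⟨l, PVal.single_self y l⟩

theorem PVal.override_dom (f g : PVal X D) : (f.override g).dom = f.dom ∪ g.dom := by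
  ext x; simp [PVal.dom, PVal.override]

theorem PVal.mergeAll_dom : ∀ {n : ℕ} (f : Fin (n + 1) → PVal X D),
    (PVal.mergeAll f).dom = ⋃ i, (f i).dom
  | 0, f => by ext x; simp [PVal.mergeAll, Fin.exists_fin_one]
  | n + 1, f => by
    ext x
    simp only [PVal.mergeAll, PVal.override_dom, mergeAll_dom, Set.mem_union, Set.mem_iUnion,
      Fin.exists_fin_succ']

theorem PVal.override_of_notMem {f g : PVal X D} {x} (h : x ∉ f.dom) :
    f.override g x = g x := by
  have : f x = none := by simpa [PVal.dom] using h
  simp [PVal.override, this]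

theorem PVal.override_of_some {f g : PVal X D} {x a} (h : f x = some a) :
    f.override g x = some a := by
  simp [PVal.override, h]

theorem PVal.restrict_eq {f v : PVal X D} (h : ∀ x a, v x = some a → f x = some a) :
    f.restrict v.dom = v := by
  funext x
  by_cases hx : x ∈ v.dom
  · obtain ⟨a, ha⟩ := Option.isSome_iff_exists.1 hx
    simp [PVal.restrict, hx, ha, h x a ha]
  · have : v x = none := by simpa [PVal.dom] using hx
    simp [PVal.restrict, hx, this]

theorem TTSB.parAll_s0 : ∀ {n : ℕ} (T : Fin (n + 1) → TTSB X D Δ C),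
    (TTSB.parAll T).s0 = PVal.mergeAll fun i => (T i).s0
  | 0, _ => rfl
  | n + 1, T => by simp [TTSB.parAll, TTSB.par, PVal.mergeAll, parAll_s0]

theorem TTSB.parAll_s0_mem : ∀ {n : ℕ} (T : Fin (n + 1) → TTSB X D Δ C),
    (∀ i, (T i).s0 ∈ (T i).S) → (∀ i j, (T i).s0.Compat (T j).s0) →
    (TTSB.parAll T).s0 ∈ (TTSB.parAll T).S
  | 0, T, h, _ => h 0
  | n + 1, T, h, hc => by
    refine ⟨_, parAll_s0_mem _ (fun i => h _) (fun i j => hc _ _), _, h _, ?_, rfl⟩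
    rw [TTSB.parAll_s0, PVal.compat_iff]
    intro x a b ha hb
    obtain ⟨i, hi⟩ := PVal.exists_of_mergeAll ha
    exact PVal.compat_iff.1 (hc _ _) x a b hi hb

theorem TA.ttsb_s0_mem (A : TA X D Δ C) : A.ttsb.s0 ∈ A.ttsb.S := by
  have hv : A.v0.dom = A.E ∪ A.H := A.v0_mem
  refine ⟨?_, A.l0, ?_, ?_⟩
  · change PVal.dom _ = _
    simp [TA.ttsb, PVal.override_dom, TA.locVal, PVal.single_dom, TA.W, hv]
  · exact (PVal.override_of_notMem (by rw [hv]; exact A.loc_fresh)).trans (PVal.single_self _ _)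
  · have : (A.ttsb.s0).restrict A.v0.dom = A.v0 :=
      PVal.restrict_eq fun x a h => PVal.override_of_some h
    rw [hv] at this
    change PVal.restrict _ _ ∈ _
    rw [TA.V, this]
    exact A.v0_inv

theorem NTA.ttsb_s0_mem (N : NTA X D Δ C n) : N.ttsb.s0 ∈ N.ttsb.S := by
  refine TTSB.parAll_s0_mem _ (fun i => (N.A i).ttsb_s0_mem) fun i j => ?_
  rcases eq_or_ne i j with rfl | hij
  · exact PVal.compat_refl _
  have h := N.compat i j hij
  have hi : (N.A i).v0.dom = (N.A i).V := (N.A i).v0_mem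
  have hj : (N.A j).v0.dom = (N.A j).V := (N.A j).v0_mem
  rw [PVal.compat_iff]
  intro x a b ha hb
  simp only [TA.ttsb, TA.locVal, PVal.override, Option.or_eq_some_iff] at ha hb
  have mem : ∀ {f : PVal X D} {a}, f x = some a → x ∈ f.dom := fun h => by simp [PVal.dom, h]
  rcases ha with ha | ⟨-, ha⟩ <;> rcases hb with hb | ⟨-, hb⟩
  · exact PVal.compat_iff.1 h.init x a b ha hb
  · obtain rfl := PVal.single_some hb
    exact absurd (hi ▸ mem ha) h.loc_right
  · obtain rfl := PVal.single_some ha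
    exact absurd (hj ▸ mem hb) h.loc_left
  · obtain rfl := PVal.single_some ha
    have h' := PVal.single_some hb
    exact absurd (Var.data.inj h') h.loc_ne

theorem NTA.s0_mem (N : NTA X D Δ C n) : N.s0 ∈ N.states := by
  have hv : ∀ i, (N.A i).v0.dom = (N.A i).V := fun i => (N.A i).v0_mem
  have hc : ∀ i j, ((N.A i).v0).Compat (N.A j).v0 := fun i j => by
    rcases eq_or_ne i j with rfl | hij
    · exact PVal.compat_refl _
    · exact (N.compat i j hij).init
  have hl : ∀ i j, ((N.A i).locVal (N.A i).l0).Compat ((N.A j).locVal (N.A j).l0) := fun i j => by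
    rcases eq_or_ne i j with rfl | hij
    · exact PVal.compat_refl _
    · rw [PVal.compat_iff]
      intro x a b ha hb
      obtain rfl := PVal.single_some ha
      have h' := PVal.single_some hb
      exact absurd (Var.data.inj h') (N.compat i j hij).loc_ne
  refine ⟨?_, fun i => ⟨(N.A i).l0, ?_, ?_⟩⟩
  · change PVal.dom _ = _
    simp only [NTA.s0, PVal.override_dom, PVal.mergeAll_dom, hv, TA.locVal, PVal.single_dom, TA.W,
      TA.V, Set.iUnion_union_distrib]
  · refine (PVal.override_of_notMem ?_).trans
      (PVal.mergeAll_of_some hl (i := i) (PVal.single_self _ _))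
    rw [PVal.mergeAll_dom, Set.mem_iUnion]
    rintro ⟨j, hj⟩
    rw [hv] at hj
    rcases eq_or_ne i j with rfl | hij
    · exact (N.A i).loc_fresh hj
    · exact (N.compat i j hij).loc_left hj
  · have : (N.s0).restrict (N.A i).v0.dom = (N.A i).v0 :=
      PVal.restrict_eq fun x a h => PVal.override_of_some (PVal.mergeAll_of_some hc h)
    rw [hv] at this
    change PVal.restrict _ _ ∈ _
    rw [this]
    exact (N.A i).v0_inv

end Init

namespace NTA

variable {X Y : Type*} {D : Y → Type} {Δ C : Type*} {n : ℕ}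

/-- The non-compositional semantics `LTS(N)`. -/
def lts (N : NTA X D Δ C n) : LTS (Act Δ C) where
  State := N.states
  init := ⟨N.s0, N.s0_mem⟩
  tr := fun s a t => N.Step s a t

/-- The compositional semantics `LTS((TTSB(A_0) ‖ ⋯ ‖ TTSB(A_n)) \ (Δ ∪ C))`. -/
def compLts (N : NTA X D Δ C n) : LTS (Act Δ C) := N.ttsb.lts N.ttsb_s0_mem

end NTA

end BroadcastTA

end

open BroadcastTA

/-! The composition is bracketed to the left, whereas the network rules treat all automata alike.
The bridge is `NetStep A J`, a bracket-free description of the transitions of the subnetwork with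
component set `J`: one component acts alone, two components shake hands, time passes for all, or a
broadcast involves every component of `J`. The open actions `c!`, `c?`, `δ!`, `δ?` are retained,
since later compositions need them.

`Represents.par` is the core: if `T₁` and `T₂` are described by `NetStep` over disjoint `J₁` and
`J₂`, then `T₁ ‖ T₂` is described by `NetStep` over `J₁ ∪ J₂`. States are split by restriction and
glued by override. Induction (`represents_parAll`) then reaches the whole network.

This works because two components share external variables only (`Compatible.mem_E`). Invariants and
input guards do not depend on these, so a step of one component leaves the others legal and their
inputs enabled or disabled as before. Broadcast inputs do not change them, so receivers neither
disturb each other nor the sender, and `s[r']` shows the receivers in the other part exactly what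
the sender has written.

Priority of committed behaviour needs a separate argument: `Comm` asks for a committed transition,
the network rules ask for a committed location. `exists_netStep_true_iff` identifies the two. A
committed location offers a legal transition of its automaton, and receptiveness supplies the
partners when that transition is a broadcast.

For the full network, hiding leaves the `τ`-steps, the delays and the former outputs `δ!`
(`ClosedStep`). The network rules evaluate all guards in the source state, fold the update functions
and set the locations last; `NetStep` lets the sender reach an intermediate valuation `w` and lets
every receiver act on `w`. By the same independence the results agree (`NTA.closedStep_of_step`,
`NTA.step_of_closedStep`). The two state sets are equal, so the isomorphism is the identity. -/

namespace BroadcastTA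

/-! ### Calculus of restriction, override, update and delay -/

namespace PVal

variable {X Y : Type*} {D : Y → Type}

theorem notMem_dom {f : PVal X D} {x : Var X Y} : x ∉ f.dom ↔ f x = none := by
  simp [dom]

theorem mem_dom_of_eq {f g : PVal X D} {x : Var X Y} (h : f x = g x) (hx : x ∈ g.dom) :
    x ∈ f.dom := by
  simpa [dom, h] using hx

theorem restrict_of_mem {f : PVal X D} {Z : Set (Var X Y)} {x : Var X Y} (h : x ∈ Z) :
    f.restrict Z x = f x := if_pos h

theorem restrict_of_notMem {f : PVal X D} {Z : Set (Var X Y)} {x : Var X Y} (h : x ∉ Z) :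
    f.restrict Z x = none := if_neg h

theorem restrict_dom (f : PVal X D) (Z : Set (Var X Y)) : (f.restrict Z).dom = f.dom ∩ Z := by
  ext x
  by_cases h : x ∈ Z <;> simp [dom, restrict, h]

theorem restrict_dom_of_subset {f : PVal X D} {Z : Set (Var X Y)} (h : Z ⊆ f.dom) :
    (f.restrict Z).dom = Z := by
  rw [restrict_dom, Set.inter_eq_right.2 h]

theorem restrict_congr {f g : PVal X D} {Z : Set (Var X Y)} (h : ∀ x ∈ Z, f x = g x) :
    f.restrict Z = g.restrict Z := by
  funext x
  by_cases hx : x ∈ Z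
  · rw [restrict_of_mem hx, restrict_of_mem hx, h x hx]
  · rw [restrict_of_notMem hx, restrict_of_notMem hx]

theorem eq_of_restrict_eq {f g : PVal X D} {Z : Set (Var X Y)}
    (h : f.restrict Z = g.restrict Z) {x : Var X Y} (hx : x ∈ Z) : f x = g x := by
  rw [← restrict_of_mem (f := f) hx, h, restrict_of_mem hx]

theorem restrict_restrict {f : PVal X D} {Z W : Set (Var X Y)} (h : Z ⊆ W) :
    (f.restrict W).restrict Z = f.restrict Z :=
  restrict_congr fun _ hx => restrict_of_mem (h hx)

theorem restrict_self {f : PVal X D} {Z : Set (Var X Y)} (h : f.dom = Z) :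
    f.restrict Z = f := by
  subst h
  exact restrict_eq fun _ _ h => h

theorem override_of_mem {f g : PVal X D} {x : Var X Y} (h : x ∈ f.dom) :
    f.override g x = f x := by
  obtain ⟨a, ha⟩ := Option.isSome_iff_exists.1 h
  rw [override_of_some ha, ha]

theorem Compat.override_right {f g : PVal X D} (h : f.Compat g) {x : Var X Y} (hx : x ∈ g.dom) :
    f.override g x = g x := by
  by_cases hf : x ∈ f.dom
  · rw [override_of_mem hf, h x ⟨hf, hx⟩]
  · exact override_of_notMem hf

theorem update_of_mem {f g : PVal X D} {x : Var X Y} (hf : x ∈ f.dom) (hg : x ∈ g.dom) :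
    f.update g x = g x := by
  rw [update, restrict_of_mem hf, override_of_mem hg]

theorem update_of_notMem {f g : PVal X D} {x : Var X Y} (hg : x ∉ g.dom) :
    f.update g x = f x := by
  by_cases hf : x ∈ f.dom
  · rw [update, restrict_of_mem hf, override_of_notMem hg]
  · rw [update, restrict_of_notMem hf, notMem_dom.1 hf]

theorem update_eq_override {f g : PVal X D} {x : Var X Y} (hf : x ∈ f.dom) :
    f.update g x = g.override f x := restrict_of_mem hf

theorem update_dom (f g : PVal X D) : (f.update g).dom = f.dom := by
  rw [update, restrict_dom, override_dom, Set.inter_eq_right]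
  exact Set.subset_union_right

theorem delay_dom (f : PVal X D) (d : ℝ≥0) : (f.delay d).dom = f.dom := by
  ext x
  cases x <;> simp [dom, delay]

theorem delay_congr {f g : PVal X D} {d : ℝ≥0} {x : Var X Y} (h : f x = g x) :
    f.delay d x = g.delay d x := by
  cases x with
  | clock x => simp only [delay, h]
  | data y => exact h

theorem restrict_delay (f : PVal X D) (Z : Set (Var X Y)) (d : ℝ≥0) :
    (f.restrict Z).delay d = (f.delay d).restrict Z := by
  funext x
  by_cases hx : x ∈ Z
  · rw [restrict_of_mem hx]
    exact delay_congr (restrict_of_mem hx)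
  · rw [restrict_of_notMem hx, ← notMem_dom, delay_dom, notMem_dom, restrict_of_notMem hx]

end PVal

/-! ### Transitions of one automaton, read in a larger valuation -/

namespace TA

variable {X Y : Type*} {D : Y → Type} {Δ C : Type*} {A : TA X D Δ C}

theorem V_subset_W : A.V ⊆ A.W := Set.subset_union_left

theorem E_subset_V : A.E ⊆ A.V := Set.subset_union_left

theorem E_subset_W : A.E ⊆ A.W := E_subset_V.trans V_subset_W

theorem loc_mem_W : Var.data A.loc ∈ A.W := Or.inr rfl

theorem ne_loc_of_mem_V {x : Var X Y} (hx : x ∈ A.V) : x ≠ Var.data A.loc := by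
  rintro rfl
  exact A.loc_fresh hx

theorem loc_notMem_E : Var.data A.loc ∉ A.E := fun h => A.loc_fresh (E_subset_V h)

theorem At.congr {s t : PVal X D} {l : D A.loc} (hs : A.At s l)
    (h : t (Var.data A.loc) = s (Var.data A.loc)) : A.At t l := h.trans hs

theorem At.unique {s : PVal X D} {l l' : D A.loc} (h : A.At s l) (h' : A.At s l') : l = l' :=
  Option.some.inj (h.symm.trans h')

theorem InCommitted.congr {s t : PVal X D} (hs : A.InCommitted s)
    (h : t (Var.data A.loc) = s (Var.data A.loc)) : A.InCommitted t :=
  let ⟨l, hl, hs⟩ := hs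
  ⟨l, hl, hs.congr h⟩

theorem holds_congr {V : Set (Var X Y)} {P : Set (PVal X D)} {s t : PVal X D}
    (h : ∀ x ∈ V, s x = t x) : Holds V P s ↔ Holds V P t := by
  rw [Holds, Holds, PVal.restrict_congr h]

theorem at_restrict {s : PVal X D} {l : D A.loc} : A.At (s.restrict A.W) l ↔ A.At s l := by
  rw [At, At, PVal.restrict_of_mem loc_mem_W]

theorem holds_restrict {P : Set (PVal X D)} {s : PVal X D} :
    Holds A.V P (s.restrict A.W) ↔ Holds A.V P s :=
  holds_congr fun _ hx => PVal.restrict_of_mem (V_subset_W hx)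

theorem inCommitted_restrict {s : PVal X D} :
    A.InCommitted (s.restrict A.W) ↔ A.InCommitted s := by
  simp only [InCommitted, at_restrict]

/-- A property that does not depend on `E` is insensitive to changes of variables in `E`. -/
theorem holds_iff_of_notDependOn {P : Set (PVal X D)} (hP : NotDependOn A.V A.E P)
    {s t : PVal X D} (hs : A.V ⊆ s.dom) (ht : A.V ⊆ t.dom)
    (h : ∀ x ∈ A.V, x ∉ A.E → s x = t x) : Holds A.V P s ↔ Holds A.V P t := by
  have key := hP (s.restrict A.V) (PVal.restrict_dom_of_subset hs) (t.restrict A.E)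
    (PVal.restrict_dom_of_subset (E_subset_V.trans ht))
  have : (s.restrict A.V).update (t.restrict A.E) = t.restrict A.V := by
    funext x
    by_cases hx : x ∈ A.V
    · by_cases hE : x ∈ A.E
      · rw [PVal.update_of_mem, PVal.restrict_of_mem hE, PVal.restrict_of_mem hx]
        · rwa [PVal.restrict_dom_of_subset hs]
        · rwa [PVal.restrict_dom_of_subset (E_subset_V.trans ht)]
      · rw [PVal.update_of_notMem, PVal.restrict_of_mem hx, PVal.restrict_of_mem hx, h x hx hE]
        rw [PVal.notMem_dom, PVal.restrict_of_notMem hE]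
    · rw [PVal.restrict_of_notMem hx, ← PVal.notMem_dom, PVal.update_dom, PVal.notMem_dom,
        PVal.restrict_of_notMem hx]
  rw [this] at key
  exact key

/-- The result of taking a transition with update function `ρ` and target location `l'`. -/
noncomputable def post (A : TA X D Δ C) (ρ : PVal X D → PVal X D) (l' : D A.loc)
    (s : PVal X D) : PVal X D :=
  (A.apply ρ s).update (A.locVal l')

theorem apply_dom (ρ : PVal X D → PVal X D) (s : PVal X D) : (A.apply ρ s).dom = s.dom :=
  PVal.update_dom _ _

theorem post_dom (ρ : PVal X D → PVal X D) (l' : D A.loc) (s : PVal X D) :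
    (A.post ρ l' s).dom = s.dom := by
  rw [post, PVal.update_dom, apply_dom]

theorem tr_update_dom {l g a ρ l'} (h : A.tr l g a ρ l') {s : PVal X D} (hs : A.V ⊆ s.dom) :
    (ρ (s.restrict A.V)).dom = A.V :=
  A.tr_update h (PVal.restrict_dom_of_subset hs)

theorem apply_of_mem {l g a ρ l'} (h : A.tr l g a ρ l') {s : PVal X D} (hs : A.V ⊆ s.dom)
    {x : Var X Y} (hx : x ∈ A.V) : A.apply ρ s x = ρ (s.restrict A.V) x :=
  PVal.update_of_mem (hs hx) (by rwa [tr_update_dom h hs])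

theorem apply_of_notMem {l g a ρ l'} (h : A.tr l g a ρ l') {s : PVal X D} (hs : A.V ⊆ s.dom)
    {x : Var X Y} (hx : x ∉ A.V) : A.apply ρ s x = s x :=
  PVal.update_of_notMem (by rwa [tr_update_dom h hs])

theorem post_loc (ρ : PVal X D → PVal X D) (l' : D A.loc) {s : PVal X D} (hs : A.W ⊆ s.dom) :
    A.post ρ l' s (Var.data A.loc) = some l' := by
  rw [post, PVal.update_of_mem, locVal, PVal.single_self]
  · rw [apply_dom]
    exact hs loc_mem_W
  · rw [locVal, PVal.single_dom]
    rfl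

theorem post_of_ne (ρ : PVal X D → PVal X D) (l' : D A.loc) {s : PVal X D} {x : Var X Y}
    (hx : x ≠ Var.data A.loc) : A.post ρ l' s x = A.apply ρ s x := by
  rw [post, PVal.update_of_notMem]
  rw [locVal, PVal.single_dom]
  exact hx

theorem post_of_mem {l g a ρ l'} (h : A.tr l g a ρ l') {s : PVal X D} (hs : A.W ⊆ s.dom)
    {x : Var X Y} (hx : x ∈ A.V) : A.post ρ l' s x = ρ (s.restrict A.V) x := by
  rw [post_of_ne _ _ (ne_loc_of_mem_V hx), apply_of_mem h (V_subset_W.trans hs) hx]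

theorem post_of_notMem {l g a ρ l'} (h : A.tr l g a ρ l') {s : PVal X D} (hs : A.W ⊆ s.dom)
    {x : Var X Y} (hx : x ∉ A.W) : A.post ρ l' s x = s x := by
  rw [post_of_ne _ _ (ne_of_mem_of_not_mem loc_mem_W hx).symm,
    apply_of_notMem h (V_subset_W.trans hs) fun hv => hx (V_subset_W hv)]

theorem post_congr {l g a ρ l'} (h : A.tr l g a ρ l') {s t : PVal X D} (hs : A.W ⊆ s.dom)
    (ht : A.W ⊆ t.dom) (hst : ∀ x ∈ A.W, s x = t x) {x : Var X Y} (hx : x ∈ A.W) :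
    A.post ρ l' s x = A.post ρ l' t x := by
  rcases hx with hx | rfl
  · rw [post_of_mem h hs hx, post_of_mem h ht hx,
      PVal.restrict_congr fun x hx => hst x (V_subset_W hx)]
  · rw [post_loc _ _ hs, post_loc _ _ ht]

/-- An update function reads and writes only variables in `V`, so the effect of a transition can be
computed in any valuation that contains `W`. This permits passing between a component and the
network. -/
theorem post_restrict {l g a ρ l'} (h : A.tr l g a ρ l') {s : PVal X D} (hs : A.W ⊆ s.dom) :
    A.post ρ l' (s.restrict A.W) = (A.post ρ l' s).restrict A.W := by
  have hr := PVal.restrict_dom_of_subset hs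
  funext x
  by_cases hx : x ∈ A.W
  · rw [PVal.restrict_of_mem hx]
    exact post_congr h hr.ge hs (fun x hx => PVal.restrict_of_mem hx) hx
  · rw [PVal.restrict_of_notMem hx, ← PVal.notMem_dom, post_dom, hr]
    exact hx

theorem restrict_mem_states {s : PVal X D} (hs : A.W ⊆ s.dom) :
    s.restrict A.W ∈ A.states ↔ ∃ l, A.At s l ∧ Holds A.V (A.I l) s := by
  simp only [states, Set.mem_ofPred_eq, at_restrict, holds_restrict, and_iff_right_iff_imp]
  exact fun _ => PVal.restrict_dom_of_subset hs

theorem subset_dom_of_restrict_mem_states {s : PVal X D} (hs : s.restrict A.W ∈ A.states) :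
    A.W ⊆ s.dom := by
  have : (s.restrict A.W).dom = A.W := hs.1
  rw [PVal.restrict_dom] at this
  exact Set.inter_eq_right.1 this

/-- Legality of a state is insensitive to changes of external variables. -/
theorem Axioms.restrict_mem_states (hax : A.Axioms) {s t : PVal X D} (ht : A.W ⊆ t.dom)
    (h : ∀ x ∈ A.W, x ∉ A.E → s x = t x) (hs : s.restrict A.W ∈ A.states) :
    t.restrict A.W ∈ A.states := by
  have hd := subset_dom_of_restrict_mem_states hs
  obtain ⟨l, hl, hI⟩ := (TA.restrict_mem_states hd).1 hs
  refine (TA.restrict_mem_states ht).2 ⟨l, hl.congr (h _ loc_mem_W loc_notMem_E).symm, ?_⟩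
  exact (holds_iff_of_notDependOn (hax.inv l) (V_subset_W.trans hd) (V_subset_W.trans ht)
    fun x hx => h x (V_subset_W hx)).1 hI

theorem Axioms.post_eq_of_mem_E (hax : A.Axioms) {l g δ ρ l'} (h : A.tr l g (.brecv δ) ρ l')
    {s : PVal X D} (hs : A.W ⊆ s.dom) {x : Var X Y} (hx : x ∈ A.E) : A.post ρ l' s x = s x := by
  rw [post_of_mem h hs (E_subset_V hx), PVal.eq_of_restrict_eq (hax.recv_update h _ ?_) hx,
    PVal.restrict_of_mem (E_subset_V hx)]
  exact PVal.restrict_dom_of_subset (V_subset_W.trans hs)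

theorem post_mem_states {l g a ρ l'} (h : A.tr l g a ρ l') {s : PVal X D} (hs : A.W ⊆ s.dom)
    (hI : ρ (s.restrict A.V) ∈ A.I l') : (A.post ρ l' s).restrict A.W ∈ A.states := by
  refine (restrict_mem_states (by rwa [post_dom])).2 ⟨l', post_loc _ _ hs, ?_⟩
  have : (A.post ρ l' s).restrict A.V = ρ (s.restrict A.V) := by
    rw [← PVal.restrict_self (tr_update_dom h (V_subset_W.trans hs))]
    exact PVal.restrict_congr fun x hx => post_of_mem h hs hx
  rw [Holds, this]
  exact hI

theorem Step.source_mem {b s a s'} (h : A.Step b s a s') : s ∈ A.states := by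
  cases h <;> assumption

theorem Step.target_mem {b s a s'} (h : A.Step b s a s') : s' ∈ A.states := by
  cases h <;> assumption

theorem Step.inCommitted {s a s'} (h : A.Step true s a s') : A.InCommitted s := by
  cases h with
  | act _ _ _ hl _ _ hb => exact ⟨_, hb.1 rfl, hl⟩

end TA

/-! ### Local steps, frame conditions and subnetwork states -/

variable {X Y : Type*} {D : Y → Type} {Δ C ι : Type*}

/-- The variables of the components in `J`. -/
def netW (A : ι → TA X D Δ C) (J : Set ι) : Set (Var X Y) := {x | ∃ i ∈ J, x ∈ (A i).W}

/-- The states of the subnetwork with the components in `J`. -/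
def netStates (A : ι → TA X D Δ C) (J : Set ι) : Set (PVal X D) :=
  {v | v.dom = netW A J ∧ ∀ i ∈ J, v.restrict (A i).W ∈ (A i).states}

namespace TA

/-- A transition of `TTSB(A)` between the parts of `v` and `v'` that belong to `A`. -/
def LocalStep (A : TA X D Δ C) (b : Bool) (v : PVal X D) (a : Act Δ C) (v' : PVal X D) : Prop :=
  A.Step b (v.restrict A.W) a (v'.restrict A.W)

/-- A transition of `TTSB(A)` that leaves all variables not belonging to `A` unchanged. -/
def FrameStep (A : TA X D Δ C) (b : Bool) (v : PVal X D) (a : Act Δ C) (v' : PVal X D) : Prop :=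
  A.LocalStep b v a v' ∧ ∀ x ∉ A.W, v' x = v x

variable {A : TA X D Δ C} {b : Bool} {a : Act Δ C} {v v' w w' : PVal X D}

theorem LocalStep.congr (h : A.LocalStep b v a v') (hw : ∀ x ∈ A.W, w x = v x)
    (hw' : ∀ x ∈ A.W, w' x = v' x) : A.LocalStep b w a w' := by
  rwa [LocalStep, PVal.restrict_congr hw, PVal.restrict_congr hw']

theorem LocalStep.subset_dom (h : A.LocalStep b v a v') : A.W ⊆ v.dom :=
  subset_dom_of_restrict_mem_states (Step.source_mem h)

theorem LocalStep.subset_dom' (h : A.LocalStep b v a v') : A.W ⊆ v'.dom :=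
  subset_dom_of_restrict_mem_states (Step.target_mem h)

theorem LocalStep.inCommitted (h : A.LocalStep true v a v') : A.InCommitted v :=
  inCommitted_restrict.1 (Step.inCommitted h)

theorem FrameStep.dom_eq (h : A.FrameStep b v a v') : v'.dom = v.dom := by
  ext x
  by_cases hx : x ∈ A.W
  · simp only [h.1.subset_dom hx, h.1.subset_dom' hx]
  · simp only [PVal.dom, Set.mem_ofPred_eq, h.2 x hx]

/-- Discrete transitions that are not virtual. -/
theorem frameStep_post {l g a ρ l'} (h : A.tr l g a ρ l') (hl : A.At v l) (hg : Holds A.V g v)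
    (hb : b = true ↔ l ∈ A.K) (hv : v.restrict A.W ∈ A.states)
    (hv' : (A.post ρ l' v).restrict A.W ∈ A.states) :
    A.FrameStep b v (.disc a) (A.post ρ l' v) := by
  have hd := subset_dom_of_restrict_mem_states hv
  exact ⟨.act hv hv' h (at_restrict.2 hl) (holds_restrict.2 hg) (post_restrict h hd).symm hb,
    fun x hx => post_of_notMem h hd hx⟩

/-- The second alternative is the virtual transition: the component ignores the broadcast, and the
step is uncommitted. -/
theorem LocalStep.disc_cases {a : DAct Δ C} (h : A.LocalStep b v (.disc a) v') :
    (∃ l g ρ l', A.tr l g a ρ l' ∧ A.At v l ∧ Holds A.V g v ∧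
      (∀ x ∈ A.W, v' x = A.post ρ l' v x) ∧ (b = true ↔ l ∈ A.K)) ∨
    ∃ δ, a = .brecv δ ∧ (¬ ∃ l g ρ l', A.tr l g (.brecv δ) ρ l' ∧ A.At v l ∧ Holds A.V g v) ∧
      (∀ x ∈ A.W, v' x = v x) ∧ b = false := by
  have hd := h.subset_dom
  rw [LocalStep] at h
  generalize hs' : v'.restrict A.W = s' at h
  cases h with
  | act _ _ ht hl hg he hb =>
    refine .inl ⟨_, _, _, _, ht, at_restrict.1 hl, holds_restrict.1 hg, fun x hx => ?_, hb⟩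
    refine PVal.eq_of_restrict_eq ?_ hx
    rw [hs', he, ← post_restrict ht hd]
    rfl
  | virt _ hn =>
    simp only [at_restrict, holds_restrict] at hn
    exact .inr ⟨_, rfl, hn, fun x hx => PVal.eq_of_restrict_eq hs' hx, rfl⟩

/-- Broadcast inputs do not change external variables. -/
theorem Axioms.localStep_brecv (hax : A.Axioms) {δ : Δ}
    (h : A.LocalStep b v (.disc (.brecv δ)) v') {x : Var X Y} (hx : x ∈ A.E) : v' x = v x := by
  rcases h.disc_cases with ⟨l, g, ρ, l', ht, -, -, he, -⟩ | ⟨-, -, -, he, -⟩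
  · rw [he x (E_subset_W hx), hax.post_eq_of_mem_E ht h.subset_dom hx]
  · exact he x (E_subset_W hx)

/-- Input-enabledness for broadcast actions. -/
theorem Receptive.exists_localStep (hrec : A.Receptive) (δ : Δ)
    (hv : v.restrict A.W ∈ A.states) : ∃ b v', A.LocalStep b v (.disc (.brecv δ)) v' := by
  by_cases hen : ∃ l g ρ l', A.tr l g (.brecv δ) ρ l' ∧ A.At v l ∧ Holds A.V g v
  · have hd := subset_dom_of_restrict_mem_states hv
    obtain ⟨l, g, ρ, l', ht, hl, hg⟩ := hen
    obtain ⟨k, hk, hI⟩ := (TA.restrict_mem_states hd).1 hv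
    obtain rfl := hl.unique hk
    -- The enabled transition at hand may violate the target invariant; receptiveness exchanges it
    -- for one that does not.
    obtain ⟨g, ρ, l', ht, hg, hI'⟩ := hrec l _ hI δ ⟨g, ρ, l', ht, hg⟩
    classical
    exact ⟨decide (l ∈ A.K), _, (frameStep_post ht hl hg decide_eq_true_iff hv
      (post_mem_states ht hd hI')).1⟩
  · refine ⟨false, v, .virt hv ?_⟩
    simpa only [at_restrict, holds_restrict] using hen

/-- A committed location has an outgoing committed transition. -/
theorem Axioms.exists_frameStep (hax : A.Axioms) (hv : v.restrict A.W ∈ A.states)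
    (hc : A.InCommitted v) : ∃ a v', A.FrameStep true v (.disc a) v' := by
  have hd := subset_dom_of_restrict_mem_states hv
  obtain ⟨l, hl, hI⟩ := (TA.restrict_mem_states hd).1 hv
  obtain ⟨k, hk, hkv⟩ := hc
  obtain rfl := hl.unique hkv
  obtain ⟨g, a, ρ, l', ht, hg, hI'⟩ := hax.committed l hk _ hI
  exact ⟨a, _, frameStep_post ht hl hg (by simp [hk]) hv (post_mem_states ht hd hI')⟩

end TA

/-! ### Bracket-free transitions of a subnetwork -/

section Net

variable {A : ι → TA X D Δ C}

/-- Internal variables of one automaton do not occur in the other, and location variables are fresh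
for both, so only external variables can be shared. All later non-interference arguments rest on
this. -/
theorem Compatible.mem_E {A B : TA X D Δ C} (h : A.Compatible B) {x : Var X Y} (hA : x ∈ A.W)
    (hB : x ∈ B.W) : x ∈ A.E := by
  rcases hA with hA | rfl
  · rcases hB with hB | rfl
    · exact hA.resolve_right fun hH => Set.eq_empty_iff_forall_notMem.1 h.left x ⟨hH, hB⟩
    · exact absurd hA h.loc_right
  · rcases hB with hB | hB
    · exact absurd hB h.loc_left
    · exact absurd (Var.data.inj hB) h.loc_ne

theorem W_subset_netW {J : Set ι} {i : ι} (hi : i ∈ J) : (A i).W ⊆ netW A J :=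
  fun _ hx => ⟨i, hi, hx⟩

theorem netW_union (J₁ J₂ : Set ι) : netW A (J₁ ∪ J₂) = netW A J₁ ∪ netW A J₂ := by
  ext x
  simp only [netW, Set.mem_union, Set.mem_ofPred_eq]
  grind

theorem netW_singleton (i : ι) : netW A {i} = (A i).W := by
  ext x
  simp [netW]

/-- The transitions of the subnetwork with the components in `J`. In the rules for handshakes and
broadcasts, `w` is the intermediate valuation after the transition of the sender. -/
inductive NetStep (A : ι → TA X D Δ C) (J : Set ι) :
    Bool → PVal X D → Act Δ C → PVal X D → Prop
  | single {i : ι} {b : Bool} {a : DAct Δ C} {v v' : PVal X D} :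
      v ∈ netStates A J → i ∈ J → ((∃ c, a = .csend c) ∨ ∃ c, a = .crecv c) →
      (A i).FrameStep b v (.disc a) v' → NetStep A J b v (.disc a) v'
  | tau {i : ι} {b : Bool} {v v' : PVal X D} :
      v ∈ netStates A J → i ∈ J → (A i).FrameStep b v (.disc .tau) v' →
      (∀ k ∈ J, (A k).InCommitted v → b = true) → NetStep A J b v (.disc .tau) v'
  | sync {i j : ι} {b b' : Bool} {c : C} {v w v' : PVal X D} :
      v ∈ netStates A J → i ∈ J → j ∈ J → i ≠ j →
      (A i).FrameStep b v (.disc (.csend c)) w → (A j).FrameStep b' w (.disc (.crecv c)) v' →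
      (∀ k ∈ J, (A k).InCommitted v → (b || b') = true) →
      NetStep A J (b || b') v (.disc .tau) v'
  | time {v : PVal X D} {d : ℝ≥0} :
      v ∈ netStates A J → (∀ i ∈ J, (A i).LocalStep false v (.delay d) (v.delay d)) →
      NetStep A J false v (.delay d) (v.delay d)
  | snd {i : ι} {b : Bool} {β : ι → Bool} {δ : Δ} {v w v' : PVal X D} :
      v ∈ netStates A J → i ∈ J → (A i).FrameStep (β i) v (.disc (.bsend δ)) w →
      (∀ j ∈ J, j ≠ i → (A j).LocalStep (β j) w (.disc (.brecv δ)) v') →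
      (∀ x ∈ (A i).W, v' x = w x) → v'.dom = netW A J →
      (b = true ↔ ∃ k ∈ J, β k = true) → NetStep A J b v (.disc (.bsend δ)) v'
  | rcv {b : Bool} {β : ι → Bool} {δ : Δ} {v v' : PVal X D} :
      v ∈ netStates A J → (∀ j ∈ J, (A j).LocalStep (β j) v (.disc (.brecv δ)) v') →
      v'.dom = netW A J → (b = true ↔ ∃ k ∈ J, β k = true) →
      NetStep A J b v (.disc (.brecv δ)) v'

theorem NetStep.delay_cases {J : Set ι} {b v d v'} (h : NetStep A J b v (.delay d) v') :
    b = false ∧ v' = v.delay d ∧ ∀ i ∈ J, (A i).LocalStep false v (.delay d) (v.delay d) := by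
  cases h with
  | time _ h => exact ⟨rfl, rfl, h⟩

theorem NetStep.source_mem {J : Set ι} {b v a v'} (h : NetStep A J b v a v') :
    v ∈ netStates A J := by
  cases h <;> assumption

theorem NetStep.dom_eq {J : Set ι} {b v a v'} (h : NetStep A J b v a v') :
    v'.dom = netW A J := by
  cases h with
  | single hv _ _ h => rw [h.dom_eq, hv.1]
  | tau hv _ h => rw [h.dom_eq, hv.1]
  | sync hv _ _ _ h h' => rw [h'.dom_eq, h.dom_eq, hv.1]
  | time hv => rw [PVal.delay_dom, hv.1]
  | snd _ _ _ _ _ hd => exact hd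
  | rcv _ _ hd => exact hd

/-- A transition of one component preserves legality of the other components. -/
theorem restrict_mem_states_of_frameStep (hc : ∀ i j, i ≠ j → (A i).Compatible (A j))
    (hax : ∀ i, (A i).Axioms) {i k : ι} (hik : k ≠ i) {b v a w}
    (h : (A i).FrameStep b v a w) (hv : v.restrict (A k).W ∈ (A k).states) :
    w.restrict (A k).W ∈ (A k).states := by
  refine (hax k).restrict_mem_states ?_ (fun x hx hE => (h.2 x fun hi => ?_).symm) hv
  · rw [h.dom_eq]
    exact TA.subset_dom_of_restrict_mem_states hv
  · exact hE (Compatible.mem_E (hc k i hik) hx hi)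

/-- The acting component is legal afterwards by the definition of its transitions; the others see at
most a change of external variables, on which their invariants do not depend. -/
theorem FrameStep.mem_netStates (hc : ∀ i j, i ≠ j → (A i).Compatible (A j))
    (hax : ∀ i, (A i).Axioms) {J : Set ι} {i : ι} {b v a w} (h : (A i).FrameStep b v a w)
    (hv : v ∈ netStates A J) : w ∈ netStates A J := by
  refine ⟨h.dom_eq.trans hv.1, fun k hk => ?_⟩
  by_cases hki : k = i
  · subst hki
    exact h.1.target_mem
  · exact restrict_mem_states_of_frameStep hc hax hki h (hv.2 k hk)

theorem FrameStep.loc_eq (hc : ∀ i j, i ≠ j → (A i).Compatible (A j)) {i k : ι} (hik : k ≠ i)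
    {b v a w} (h : (A i).FrameStep b v a w) :
    w (Var.data (A k).loc) = v (Var.data (A k).loc) :=
  h.2 _ fun hi => TA.loc_notMem_E (Compatible.mem_E (hc k i hik) TA.loc_mem_W hi)

open Classical in
/-- Valuations of the components that agree with `w` on external variables can be merged. -/
theorem exists_merge (hc : ∀ i j, i ≠ j → (A i).Compatible (A j)) {J : Set ι} {w : PVal X D}
    (r : ι → PVal X D) (hd : ∀ j ∈ J, (A j).W ⊆ (r j).dom)
    (hr : ∀ j ∈ J, ∀ x ∈ (A j).E, r j x = w x) :
    ∃ v' : PVal X D, v'.dom = netW A J ∧ ∀ j ∈ J, ∀ x ∈ (A j).W, v' x = r j x := by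
  let v' : PVal X D := fun x => if h : ∃ j ∈ J, x ∈ (A j).W then r h.choose x else none
  have key : ∀ j ∈ J, ∀ x ∈ (A j).W, v' x = r j x := by
    intro j hj x hx
    have h : ∃ j ∈ J, x ∈ (A j).W := ⟨j, hj, hx⟩
    have e : v' x = r h.choose x := dif_pos h
    rw [e]
    obtain ⟨hJ, hW⟩ := h.choose_spec
    -- The chosen owner of `x` may differ from `j`; then `x` is external for both, and both values
    -- equal `w x`.
    by_cases hj' : h.choose = j
    · rw [hj']
    · rw [hr _ hJ x (Compatible.mem_E (hc _ _ hj') hW hx),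
        hr _ hj x (Compatible.mem_E (hc _ _ (Ne.symm hj')) hx hW)]
  refine ⟨v', Set.ext fun x => ⟨fun hx => ?_, fun ⟨j, hj, hx⟩ => ?_⟩, key⟩
  · by_contra hn
    exact PVal.notMem_dom.2 (dif_neg hn) hx
  · exact PVal.mem_dom_of_eq (key j hj x hx) (hd j hj hx)

/-- A state of a subnetwork is committed iff one of its components is in a committed location. -/
theorem exists_netStep_true_iff (hc : ∀ i j, i ≠ j → (A i).Compatible (A j))
    (hax : ∀ i, (A i).Axioms) (hrec : ∀ i, (A i).Receptive) {J : Set ι} {v : PVal X D}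
    (hv : v ∈ netStates A J) :
    (∃ a v', NetStep A J true v a v') ↔ ∃ k ∈ J, (A k).InCommitted v := by
  constructor
  · rintro ⟨a, v', h⟩
    generalize hb : true = b at h
    cases h with
    | single _ hi _ h => subst hb; exact ⟨_, hi, h.1.inCommitted⟩
    | tau _ hi h => subst hb; exact ⟨_, hi, h.1.inCommitted⟩
    | @sync i j b b' _ _ _ _ _ hi hj hij h h' =>
      cases b with
      | true => exact ⟨_, hi, h.1.inCommitted⟩
      | false =>
        obtain rfl : true = b' := hb
        -- The receiver is known to be committed in the intermediate valuation only, but the sender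
        -- does not touch its location.
        exact ⟨_, hj, h'.1.inCommitted.congr (FrameStep.loc_eq hc hij.symm h).symm⟩
    | time => cases hb
    | @snd i _ β _ _ _ _ _ hi h h' _ _ hβ =>
      obtain ⟨k, hk, hβ⟩ := hβ.1 hb.symm
      by_cases hki : k = i
      · subst hki
        rw [hβ] at h
        exact ⟨_, hk, h.1.inCommitted⟩
      · have := h' k hk hki
        rw [hβ] at this
        exact ⟨_, hk, this.inCommitted.congr (FrameStep.loc_eq hc hki h).symm⟩
    | rcv _ h _ hβ =>
      obtain ⟨k, hk, hβ⟩ := hβ.1 hb.symm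
      have := h k hk
      rw [hβ] at this
      exact ⟨_, hk, this.inCommitted⟩
  · rintro ⟨k, hk, hcom⟩
    obtain ⟨a, w, h⟩ := (hax k).exists_frameStep (hv.2 k hk) hcom
    have hw := FrameStep.mem_netStates hc hax h hv
    cases a with
    | csend c => exact ⟨_, _, .single hv hk (.inl ⟨c, rfl⟩) h⟩
    | crecv c => exact ⟨_, _, .single hv hk (.inr ⟨c, rfl⟩) h⟩
    | tau => exact ⟨_, _, .tau hv hk h fun _ _ _ => rfl⟩
    | bsend δ =>
      -- A committed output is a transition of the subnetwork only together with a reaction of every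
      -- other component, which receptiveness provides. The sender itself is assigned `w` and the
      -- bit `true`; the values for `j ∉ J` are arbitrary.
      have : ∀ j, ∃ β r, j ∈ J → (j = k → β = true ∧ r = w) ∧
          (j ≠ k → (A j).LocalStep β w (.disc (.brecv δ)) r) := by
        intro j
        by_cases hjk : j = k
        · exact ⟨true, w, fun _ => ⟨fun _ => ⟨rfl, rfl⟩, fun h => absurd hjk h⟩⟩
        by_cases hj : j ∈ J
        · obtain ⟨β, r, h⟩ := (hrec j).exists_localStep δ (hw.2 j hj)
          exact ⟨β, r, fun _ => ⟨fun h => absurd h hjk, fun _ => h⟩⟩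
        · exact ⟨true, w, fun h => absurd h hj⟩
      choose β r hr using this
      have hrk := (hr k hk).1 rfl
      -- The reactions are computed separately from `w`; they keep external variables, hence fit
      -- together.
      obtain ⟨v', hd, hv'⟩ := exists_merge (w := w) hc r
        (fun j hj => by
          by_cases hjk : j = k
          · rw [((hr j hj).1 hjk).2, hw.1]
            exact W_subset_netW hj
          · exact ((hr j hj).2 hjk).subset_dom')
        (fun j hj x hx => by
          by_cases hjk : j = k
          · rw [((hr j hj).1 hjk).2]
          · exact (hax j).localStep_brecv ((hr j hj).2 hjk) hx)
      refine ⟨_, _, .snd (β := β) hv hk (by rwa [hrk.1])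
        (fun j hj hjk => ((hr j hj).2 hjk).congr (fun _ _ => rfl) (hv' j hj))
        (fun x hx => by rw [hv' k hk x hx, hrk.2]) hd ?_⟩
      simpa using ⟨k, hk, hrk.1⟩
    | brecv δ =>
      -- Here the committed component is itself a receiver, so there is no intermediate valuation
      -- and all reactions start in `v`.
      have : ∀ j, ∃ β r, j ∈ J → (j = k → β = true) ∧
          (A j).LocalStep β v (.disc (.brecv δ)) r := by
        intro j
        by_cases hjk : j = k
        · subst hjk
          exact ⟨true, w, fun _ => ⟨fun _ => rfl, h.1⟩⟩
        by_cases hj : j ∈ J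
        · obtain ⟨β, r, h⟩ := (hrec j).exists_localStep δ (hv.2 j hj)
          exact ⟨β, r, fun _ => ⟨fun h => absurd h hjk, h⟩⟩
        · exact ⟨true, w, fun h => absurd h hj⟩
      choose β r hr using this
      obtain ⟨v', hd, hv'⟩ := exists_merge (w := v) hc r (fun j hj => (hr j hj).2.subset_dom')
        (fun j hj x hx => (hax j).localStep_brecv (hr j hj).2 hx)
      refine ⟨_, _, .rcv (β := β) hv
        (fun j hj => (hr j hj).2.congr (fun _ _ => rfl) (hv' j hj)) hd ?_⟩
      simpa using ⟨k, hk, (hr k hk).1 rfl⟩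

end Net

/-! ### Splitting and gluing states of subnetworks -/

variable {A : ι → TA X D Δ C}

theorem PVal.restrict_override_restrict {v : PVal X D} {Z W : Set (Var X Y)}
    (h : v.dom ⊆ Z ∪ W) : (v.restrict Z).override (v.restrict W) = v := by
  funext x
  by_cases hZ : x ∈ Z
  · by_cases hv : x ∈ v.dom
    · rw [PVal.override_of_mem, PVal.restrict_of_mem hZ]
      rw [PVal.restrict_dom]
      exact ⟨hv, hZ⟩
    · rw [PVal.notMem_dom.1 hv, ← PVal.notMem_dom, PVal.override_dom, PVal.restrict_dom,
        PVal.restrict_dom]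
      exact fun h => h.elim (fun h => hv h.1) (fun h => hv h.1)
  · rw [PVal.override_of_notMem (PVal.notMem_dom.2 (PVal.restrict_of_notMem hZ))]
    by_cases hW : x ∈ W
    · exact PVal.restrict_of_mem hW
    · rw [PVal.restrict_of_notMem hW, eq_comm, ← PVal.notMem_dom]
      exact fun hv => (h hv).elim hZ hW

theorem PVal.compat_restrict_restrict (v : PVal X D) (Z W : Set (Var X Y)) :
    (v.restrict Z).Compat (v.restrict W) := by
  rintro x ⟨hZ, hW⟩
  rw [PVal.restrict_dom] at hZ hW
  rw [PVal.restrict_of_mem hZ.2, PVal.restrict_of_mem hW.2]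

theorem override_mem_netStates {J₁ J₂ : Set ι} {r s : PVal X D} (hr : r ∈ netStates A J₁)
    (hs : s ∈ netStates A J₂) (h : r.Compat s) : r.override s ∈ netStates A (J₁ ∪ J₂) := by
  refine ⟨by rw [PVal.override_dom, hr.1, hs.1, netW_union], ?_⟩
  rintro i (hi | hi)
  · rw [PVal.restrict_congr fun x hx => PVal.override_of_mem
      (hr.1.symm ▸ W_subset_netW hi hx : x ∈ r.dom)]
    exact hr.2 i hi
  · rw [PVal.restrict_congr fun x hx => h.override_right
      (hs.1.symm ▸ W_subset_netW hi hx : x ∈ s.dom)]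
    exact hs.2 i hi

theorem netW_mono {J J' : Set ι} (h : J ⊆ J') : netW A J ⊆ netW A J' :=
  fun _ ⟨i, hi, hx⟩ => ⟨i, h hi, hx⟩

theorem restrict_mem_netStates {J J' : Set ι} (h : J ⊆ J') {v : PVal X D}
    (hv : v ∈ netStates A J') : v.restrict (netW A J) ∈ netStates A J := by
  refine ⟨PVal.restrict_dom_of_subset (hv.1.symm ▸ netW_mono h), fun i hi => ?_⟩
  rw [PVal.restrict_restrict (W_subset_netW hi)]
  exact hv.2 i (h hi)

/-- A frame step is determined by what happens on `B.W`, so it survives any change of surroundings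
outside `Z ⊇ B.W` as long as these stay constant. Both extension by `override` and restriction are
instances. -/
theorem TA.FrameStep.transfer {B : TA X D Δ C} {b a} {v v' u u' : PVal X D}
    (h : B.FrameStep b v a v') {Z : Set (Var X Y)} (hZ : B.W ⊆ Z) (hu : ∀ x ∈ Z, u x = v x)
    (hu' : ∀ x ∈ Z, u' x = v' x) (hn : ∀ x ∉ Z, u' x = u x) : B.FrameStep b u a u' := by
  refine ⟨h.1.congr (fun x hx => hu x (hZ hx)) (fun x hx => hu' x (hZ hx)), fun x hx => ?_⟩
  by_cases hxZ : x ∈ Z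
  · rw [hu x hxZ, hu' x hxZ, h.2 x hx]
  · exact hn x hxZ

theorem TA.FrameStep.override {B : TA X D Δ C} {b a} {r r' : PVal X D}
    (h : B.FrameStep b r a r') (s : PVal X D) :
    B.FrameStep b (r.override s) a (r'.override s) := by
  refine h.transfer (Z := r.dom) h.1.subset_dom (fun x hx => PVal.override_of_mem hx)
    (fun x hx => PVal.override_of_mem (by rwa [h.dom_eq])) fun x hx => ?_
  rw [PVal.override_of_notMem hx, PVal.override_of_notMem (by rwa [h.dom_eq])]

theorem TA.FrameStep.restrict {B : TA X D Δ C} {b a} {v v' : PVal X D}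
    (h : B.FrameStep b v a v') {Z : Set (Var X Y)} (hZ : B.W ⊆ Z) :
    B.FrameStep b (v.restrict Z) a (v'.restrict Z) :=
  h.transfer hZ (fun _ hx => PVal.restrict_of_mem hx) (fun _ hx => PVal.restrict_of_mem hx)
    fun _ hx => by rw [PVal.restrict_of_notMem hx, PVal.restrict_of_notMem hx]

theorem TA.LocalStep.restrict {B : TA X D Δ C} {b a} {v v' : PVal X D}
    (h : B.LocalStep b v a v') {Z : Set (Var X Y)} (hZ : B.W ⊆ Z) :
    B.LocalStep b (v.restrict Z) a (v'.restrict Z) :=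
  h.congr (fun _ hx => PVal.restrict_of_mem (hZ hx)) (fun _ hx => PVal.restrict_of_mem (hZ hx))

/-- `T` is the composition of the components in `J`. -/
structure Represents (A : ι → TA X D Δ C) (J : Set ι) (T : TTSB X D Δ C) : Prop where
  S_eq : T.S = netStates A J
  tr_iff : ∀ b v a v', T.tr b v a v' ↔ NetStep A J b v a v'

theorem Represents.comm_iff {J : Set ι} {T : TTSB X D Δ C} (h : Represents A J T)
    (hc : ∀ i j, i ≠ j → (A i).Compatible (A j)) (hax : ∀ i, (A i).Axioms)
    (hrec : ∀ i, (A i).Receptive) {v : PVal X D} (hv : v ∈ netStates A J) :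
    T.Comm v ↔ ∃ k ∈ J, (A k).InCommitted v := by
  simp only [TTSB.Comm, h.tr_iff]
  exact exists_netStep_true_iff hc hax hrec hv

theorem inCommitted_congr {B : TA X D Δ C} {s t : PVal X D} (h : ∀ x ∈ B.W, s x = t x) :
    B.InCommitted s ↔ B.InCommitted t :=
  ⟨fun hs => hs.congr (h _ TA.loc_mem_W).symm, fun ht => ht.congr (h _ TA.loc_mem_W)⟩

/-! ### From transitions of a binary composition to the subnetwork -/

section Par

variable {J₁ J₂ : Set ι} {T₁ T₂ : TTSB X D Δ C}

/-- Receivers of a broadcast do not interfere with variables of other components. -/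
theorem eq_of_brecv (hc : ∀ i j, i ≠ j → (A i).Compatible (A j)) (hax : ∀ i, (A i).Axioms)
    {J : Set ι} {i k : ι} {β : ι → Bool} {δ : Δ} {w v' : PVal X D}
    (h : ∀ j ∈ J, j ≠ i → (A j).LocalStep (β j) w (.disc (.brecv δ)) v')
    (hi : ∀ x ∈ (A i).W, v' x = w x) (hk : k ∉ J) {x : Var X Y} (hx : x ∈ netW A J)
    (hxk : x ∈ (A k).W) : v' x = w x := by
  obtain ⟨j, hj, hxj⟩ := hx
  by_cases hji : j = i
  · subst hji
    exact hi x hxj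
  · exact (hax j).localStep_brecv (h j hj hji)
      (Compatible.mem_E (hc j k (ne_of_mem_of_not_mem hj hk)) hxj hxk)

/-- Each rule of the composition combines steps of the two halves that are known in bracket-free
form. Participants are pooled, commitment bits are pasted together, and `Comm` is replaced by the
presence of a committed location. -/
theorem Represents.netStep_of_parStep (hc : ∀ i j, i ≠ j → (A i).Compatible (A j))
    (hax : ∀ i, (A i).Axioms) (hrec : ∀ i, (A i).Receptive) (h₁ : Represents A J₁ T₁)
    (h₂ : Represents A J₂ T₂) (hJ : Disjoint J₁ J₂) {b u a u'}
    (h : TTSB.ParStep T₁ T₂ b u a u') : NetStep A (J₁ ∪ J₂) b u a u' := by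
  classical
  have hcomm : ∀ {r s : PVal X D}, r ∈ netStates A J₁ → s ∈ netStates A J₂ → r.Compat s →
      ∀ k ∈ J₁ ∪ J₂, (A k).InCommitted (r.override s) →
        (k ∈ J₁ ∧ (A k).InCommitted r) ∨ (k ∈ J₂ ∧ (A k).InCommitted s) := by
    intro r s hr hs hrs k hk hkc
    refine hk.imp (fun hk => ⟨hk, ?_⟩) (fun hk => ⟨hk, ?_⟩)
    · exact (inCommitted_congr fun x hx => PVal.override_of_mem
        (hr.1.symm ▸ W_subset_netW hk hx : x ∈ r.dom)).1 hkc
    · exact (inCommitted_congr fun x hx => hrs.override_right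
        (hs.1.symm ▸ W_subset_netW hk hx : x ∈ s.dom)).1 hkc
  have hnot : ∀ {k}, k ∈ J₂ → k ∉ J₁ := fun h₂ h₁ => Set.disjoint_left.1 hJ h₁ h₂
  have hβ : ∀ {b b' : Bool} {β β' : ι → Bool}, (b = true ↔ ∃ k ∈ J₁, β k = true) →
      (b' = true ↔ ∃ k ∈ J₂, β' k = true) → ((b || b') = true ↔
        ∃ k ∈ J₁ ∪ J₂, (if k ∈ J₁ then β k else β' k) = true) := by
    intro b b' β β' h h'
    rw [Bool.or_eq_true, h, h']
    constructor
    · rintro (⟨k, hk, hβ⟩ | ⟨k, hk, hβ⟩)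
      · exact ⟨k, .inl hk, by rwa [if_pos hk]⟩
      · exact ⟨k, .inr hk, by rwa [if_neg (hnot hk)]⟩
    · rintro ⟨k, hk, hβ⟩
      split at hβ
      · next hk => exact .inl ⟨k, hk, hβ⟩
      · next hk' => exact .inr ⟨k, hk.resolve_left hk', hβ⟩
  cases h with
  | ext hr hs hrs ha h =>
    rw [h₁.S_eq] at hr
    rw [h₂.S_eq] at hs
    rw [h₁.tr_iff] at h
    have hu := override_mem_netStates hr hs hrs
    cases h with
    | single _ hi _ h => exact .single hu (.inl hi) ha (h.override _)
    | tau | sync | snd | rcv => simp at ha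
  | @tau r s r' _ hr hs hrs h hcs =>
    rw [h₁.S_eq] at hr
    rw [h₂.S_eq] at hs
    rw [h₁.tr_iff] at h
    rw [h₂.comm_iff hc hax hrec hs] at hcs
    have hu := override_mem_netStates hr hs hrs
    cases h with
    | single _ _ ha => simp at ha
    | tau _ hi h hk =>
      refine .tau hu (.inl hi) (h.override _) fun k hkJ hkc => ?_
      exact (hcomm hr hs hrs k hkJ hkc).elim (fun h => hk k h.1 h.2) (fun h => hcs ⟨k, h⟩)
    | sync _ hi hj hij h h' hk =>
      refine .sync hu (.inl hi) (.inl hj) hij (h.override _) (h'.override _) fun k hkJ hkc => ?_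
      exact (hcomm hr hs hrs k hkJ hkc).elim (fun h => hk k h.1 h.2) (fun h => hcs ⟨k, h⟩)
  | @sync r s r' s' _ _ _ hr hs hrs h h' hcs =>
    rw [h₁.S_eq] at hr
    rw [h₂.S_eq] at hs
    rw [h₁.tr_iff] at h
    rw [h₂.tr_iff] at h'
    rw [h₁.comm_iff hc hax hrec hr, h₂.comm_iff hc hax hrec hs] at hcs
    have hu := override_mem_netStates hr hs hrs
    cases h with
    | @single i _ _ _ _ _ hi _ h =>
      cases h' with
      | @single j _ _ _ _ _ hj _ h' =>
        refine .sync hu (.inl hi) (.inr hj) (ne_of_mem_of_not_mem hi (hnot hj)) (h.override s)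
          (v' := s'.override r') ?_ fun k hkJ hkc => ?_
        -- On `s.dom` the glued valuation `r' ▷ s` coincides with `s[r']`, where the receiver
        -- starts; off `s.dom` both `r' ▷ s` and `s' ▷ r'` are given by `r'`.
        · have hd : s'.dom = s.dom := by rw [h'.dom_eq, PVal.update_dom]
          refine h'.transfer (Z := s.dom) ?_ (fun x hx => (PVal.update_eq_override hx).symm)
            (fun x hx => PVal.override_of_mem (by rwa [hd])) fun x hx => ?_
          · rw [hs.1]
            exact W_subset_netW hj
          · rw [PVal.override_of_notMem (by rwa [hd])]
            by_cases hx' : x ∈ r'.dom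
            · rw [PVal.override_of_mem hx']
            · rw [PVal.override_of_notMem hx', PVal.notMem_dom.1 hx, PVal.notMem_dom.1 hx']
        · exact hcs ((hcomm hr hs hrs k hkJ hkc).imp (fun h => ⟨k, h⟩) (fun h => ⟨k, h⟩))
  | @time r s r' s' d hr hs hrs h h' hrs' =>
    rw [h₁.S_eq] at hr
    rw [h₂.S_eq] at hs
    rw [h₁.tr_iff] at h
    rw [h₂.tr_iff] at h'
    have hu := override_mem_netStates hr hs hrs
    obtain ⟨-, rfl, hl⟩ := h.delay_cases
    obtain ⟨-, rfl, hl'⟩ := h'.delay_cases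
    have e : (r.delay d).override (s.delay d) = (r.override s).delay d := by
      funext x
      by_cases hx : x ∈ r.dom
      · rw [PVal.override_of_mem (by rwa [PVal.delay_dom]),
          PVal.delay_congr (PVal.override_of_mem hx)]
      · rw [PVal.override_of_notMem (by rwa [PVal.delay_dom]),
          PVal.delay_congr (PVal.override_of_notMem hx)]
    rw [e]
    refine .time hu fun i hi => ?_
    rcases hi with hi | hi
    · have : ∀ x ∈ (A i).W, r.override s x = r x := fun x hx =>
        PVal.override_of_mem (hr.1.symm ▸ W_subset_netW hi hx)
      exact (hl i hi).congr this fun x hx => PVal.delay_congr (this x hx)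
    · have : ∀ x ∈ (A i).W, r.override s x = s x := fun x hx =>
        hrs.override_right (hs.1.symm ▸ W_subset_netW hi hx)
      exact (hl' i hi).congr this fun x hx => PVal.delay_congr (this x hx)
  | @snd r s r' s' _ _ _ hr hs hrs h h' hrs' =>
    rw [h₁.S_eq] at hr
    rw [h₂.S_eq] at hs
    rw [h₁.tr_iff] at h
    rw [h₂.tr_iff] at h'
    have hu := override_mem_netStates hr hs hrs
    have hd := h.dom_eq
    have hd' := h'.dom_eq
    cases h with
    | single _ _ ha => simp at ha
    | @snd i _ β _ _ w _ _ hi h hj hwi _ hb =>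
      have hw : w.dom = netW A J₁ := by rw [h.dom_eq, hr.1]
      cases h' with
      | single _ _ ha => simp at ha
      | @rcv _ β' _ _ _ _ h' _ hb' =>
        refine .snd (β := fun k => if k ∈ J₁ then β k else β' k) hu (.inl hi)
          (w := w.override s) ?_ (fun j hjJ hji => ?_) (fun x hx => ?_) ?_ (hβ hb hb')
        · simp only [if_pos hi]
          exact h.override s
        · rcases hjJ with hjJ | hjJ
          · simp only [if_pos hjJ]
            exact (hj j hjJ hji).congr
              (fun x hx => PVal.override_of_mem (hw.symm ▸ W_subset_netW hjJ hx))
              (fun x hx => PVal.override_of_mem (hd.symm ▸ W_subset_netW hjJ hx))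
          · simp only [if_neg (hnot hjJ)]
            refine (h' j hjJ).congr (fun x hx => ?_)
              (fun x hx => hrs'.override_right (hd'.symm ▸ W_subset_netW hjJ hx))
            have hxs : x ∈ s.dom := hs.1.symm ▸ W_subset_netW hjJ hx
            rw [PVal.update_eq_override hxs]
            -- The receivers in `J₂` start in `s[r']`, where `r'` also contains the reactions of the
            -- receivers in `J₁`, and not in `w ▷ s`. On shared variables this makes no difference,
            -- because those reactions leave them unchanged.
            by_cases hxw : x ∈ netW A J₁
            · rw [PVal.override_of_mem (hw.symm ▸ hxw), PVal.override_of_mem (hd.symm ▸ hxw),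
                eq_of_brecv hc hax hj hwi (hnot hjJ) hxw hx]
            · rw [PVal.override_of_notMem (hw.symm ▸ hxw),
                PVal.override_of_notMem (hd.symm ▸ hxw)]
        · rw [PVal.override_of_mem (hd.symm ▸ W_subset_netW hi hx),
            PVal.override_of_mem (hw.symm ▸ W_subset_netW hi hx), hwi x hx]
        · rw [PVal.override_dom, hd, hd', netW_union]
  | @rcv r s r' s' _ _ _ hr hs hrs h h' hrs' =>
    rw [h₁.S_eq] at hr
    rw [h₂.S_eq] at hs
    rw [h₁.tr_iff] at h
    rw [h₂.tr_iff] at h'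
    have hu := override_mem_netStates hr hs hrs
    have hd := h.dom_eq
    have hd' := h'.dom_eq
    cases h with
    | single _ _ ha => simp at ha
    | @rcv _ β _ _ _ _ h _ hb =>
      cases h' with
      | single _ _ ha => simp at ha
      | @rcv _ β' _ _ _ _ h' _ hb' =>
        refine .rcv (β := fun k => if k ∈ J₁ then β k else β' k) hu (fun j hjJ => ?_) ?_
          (hβ hb hb')
        · rcases hjJ with hjJ | hjJ
          · simp only [if_pos hjJ]
            exact (h j hjJ).congr
              (fun x hx => PVal.override_of_mem (hr.1.symm ▸ W_subset_netW hjJ hx))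
              (fun x hx => PVal.override_of_mem (hd.symm ▸ W_subset_netW hjJ hx))
          · simp only [if_neg (hnot hjJ)]
            exact (h' j hjJ).congr
              (fun x hx => hrs.override_right (hs.1.symm ▸ W_subset_netW hjJ hx))
              (fun x hx => hrs'.override_right (hd'.symm ▸ W_subset_netW hjJ hx))
        · rw [PVal.override_dom, hd, hd', netW_union]

end Par

theorem PVal.restrict_override_of_eq {v v' : PVal X D} {Z W : Set (Var X Y)} (hZ : Z ⊆ v'.dom)
    (hv : v.dom ⊆ Z ∪ W) (h : ∀ x ∉ Z, v' x = v x) :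
    (v'.restrict Z).override (v.restrict W) = v' := by
  funext x
  by_cases hx : x ∈ Z
  · rw [PVal.override_of_mem (by rw [PVal.restrict_dom_of_subset hZ]; exact hx),
      PVal.restrict_of_mem hx]
  · rw [PVal.override_of_notMem (PVal.notMem_dom.2 (PVal.restrict_of_notMem hx)), h x hx]
    by_cases hW : x ∈ W
    · exact PVal.restrict_of_mem hW
    · rw [PVal.restrict_of_notMem hW, eq_comm, ← PVal.notMem_dom]
      exact fun hv' => (hv hv').elim hx hW

theorem inCommitted_restrict_netW {J : Set ι} {k : ι} (hk : k ∈ J) {v : PVal X D} :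
    (A k).InCommitted (v.restrict (netW A J)) ↔ (A k).InCommitted v :=
  inCommitted_congr fun _ hx => PVal.restrict_of_mem (W_subset_netW hk hx)

/-! ### From the subnetwork to transitions of a binary composition -/

section Par

variable {J₁ J₂ : Set ι} {T₁ T₂ : TTSB X D Δ C}

theorem Represents.restrict_mem (h₁ : Represents A J₁ T₁) {u : PVal X D}
    (hu : u ∈ netStates A (J₁ ∪ J₂)) : u.restrict (netW A J₁) ∈ T₁.S := by
  rw [h₁.S_eq]
  exact restrict_mem_netStates Set.subset_union_left hu

theorem restrict_override_restrict_netW {u : PVal X D} (hu : u.dom = netW A (J₁ ∪ J₂)) :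
    (u.restrict (netW A J₁)).override (u.restrict (netW A J₂)) = u :=
  PVal.restrict_override_restrict (by rw [hu, netW_union])

theorem restrict_override_restrict_netW_of_frameStep {u u' : PVal X D}
    (hu : u.dom = netW A (J₁ ∪ J₂)) (hu' : u'.dom = u.dom) (h : ∀ x ∉ netW A J₁, u' x = u x) :
    (u'.restrict (netW A J₁)).override (u.restrict (netW A J₂)) = u' := by
  refine PVal.restrict_override_of_eq ?_ (by rw [hu, netW_union]) h
  rw [hu', hu]
  exact netW_mono Set.subset_union_left

theorem TA.FrameStep.eq_of_notMem_netW {J : Set ι} {i : ι} (hi : i ∈ J) {b a} {v v' : PVal X D}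
    (h : (A i).FrameStep b v a v') {x : Var X Y} (hx : x ∉ netW A J) : v' x = v x :=
  h.2 x fun hx' => hx (W_subset_netW hi hx')

theorem Represents.parStep_single (h₁ : Represents A J₁ T₁) (h₂ : Represents A J₂ T₂)
    {u u' : PVal X D} {b : Bool} {a : DAct Δ C} {i : ι} (hu : u ∈ netStates A (J₁ ∪ J₂))
    (hi : i ∈ J₁) (ha : (∃ c, a = .csend c) ∨ ∃ c, a = .crecv c)
    (h : (A i).FrameStep b u (.disc a) u') : TTSB.ParStep T₁ T₂ b u (.disc a) u' := by
  have hr := h₁.restrict_mem hu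
  have := TTSB.ParStep.ext hr (h₂.restrict_mem (Set.union_comm J₁ J₂ ▸ hu))
    (PVal.compat_restrict_restrict _ _ _) ha
    ((h₁.tr_iff _ _ _ _).2 (.single (h₁.S_eq ▸ hr) hi ha (h.restrict (W_subset_netW hi))))
  rwa [restrict_override_restrict_netW hu.1,
    restrict_override_restrict_netW_of_frameStep hu.1 h.dom_eq
      fun x hx => h.eq_of_notMem_netW hi hx] at this

/-- The assumption is a `τ`-step of the whole half `J₁`, so that internal steps of one component and
handshakes inside `J₁` are covered at once. -/
theorem Represents.parStep_tau (hc : ∀ i j, i ≠ j → (A i).Compatible (A j))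
    (hax : ∀ i, (A i).Axioms) (hrec : ∀ i, (A i).Receptive) (h₁ : Represents A J₁ T₁)
    (h₂ : Represents A J₂ T₂) {u u' : PVal X D} {b : Bool}
    (hu : u ∈ netStates A (J₁ ∪ J₂)) (hu' : u'.dom = u.dom)
    (hn : ∀ x ∉ netW A J₁, u' x = u x)
    (hk : ∀ k ∈ J₁ ∪ J₂, (A k).InCommitted u → b = true)
    (h : NetStep A J₁ b (u.restrict (netW A J₁)) (.disc .tau) (u'.restrict (netW A J₁))) :
    TTSB.ParStep T₁ T₂ b u (.disc .tau) u' := by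
  have hs := h₂.restrict_mem (Set.union_comm J₁ J₂ ▸ hu)
  have := TTSB.ParStep.tau (h₁.restrict_mem hu) hs
    (PVal.compat_restrict_restrict _ _ _) ((h₁.tr_iff _ _ _ _).2 h) (fun hcs => by
      obtain ⟨k, hkJ, hkc⟩ := (h₂.comm_iff hc hax hrec (h₂.S_eq ▸ hs)).1 hcs
      exact hk k (.inr hkJ) ((inCommitted_restrict_netW hkJ).1 hkc))
  rwa [restrict_override_restrict_netW hu.1,
    restrict_override_restrict_netW_of_frameStep hu.1 hu' hn] at this

/-- The handshake across the two halves: each half contributes an open `c!` or `c?` step of a single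
component, which is unconditional, and priority is checked only when the two are combined. -/
theorem Represents.parStep_sync (hc : ∀ i j, i ≠ j → (A i).Compatible (A j))
    (hax : ∀ i, (A i).Axioms) (hrec : ∀ i, (A i).Receptive) (h₁ : Represents A J₁ T₁)
    (h₂ : Represents A J₂ T₂) {u w u' : PVal X D} {b b' : Bool} {c : C} {i j : ι}
    (hu : u ∈ netStates A (J₁ ∪ J₂)) (hi : i ∈ J₁) (hj : j ∈ J₂)
    (h : (A i).FrameStep b u (.disc (.csend c)) w)
    (h' : (A j).FrameStep b' w (.disc (.crecv c)) u')
    (hk : ∀ k ∈ J₁ ∪ J₂, (A k).InCommitted u → (b || b') = true) :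
    TTSB.ParStep T₁ T₂ (b || b') u (.disc .tau) u' := by
  have hr := h₁.restrict_mem hu
  have hs := h₂.restrict_mem (Set.union_comm J₁ J₂ ▸ hu)
  have hw := FrameStep.mem_netStates hc hax h hu
  have hws := h₂.restrict_mem (Set.union_comm J₁ J₂ ▸ hw)
  have hW₂ : netW A J₂ ⊆ u.dom := hu.1.symm ▸ netW_mono Set.subset_union_right
  have hW₁ : netW A J₁ ⊆ w.dom := hw.1.symm ▸ netW_mono Set.subset_union_left
  -- The state `s[r']` of the receiving half is its part of the intermediate valuation `w`.
  have e : (u.restrict (netW A J₂)).update (w.restrict (netW A J₁)) =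
      w.restrict (netW A J₂) := by
    rw [← PVal.restrict_self (PVal.update_dom _ _), PVal.restrict_dom_of_subset hW₂]
    refine PVal.restrict_congr fun x hx => ?_
    rw [PVal.update_eq_override (by rwa [PVal.restrict_dom_of_subset hW₂]),
      restrict_override_restrict_netW_of_frameStep hu.1 h.dom_eq
        fun x hx => h.eq_of_notMem_netW hi hx]
  have := TTSB.ParStep.sync (b' := b') (s' := u'.restrict (netW A J₂)) hr hs
    (PVal.compat_restrict_restrict _ _ _)
    ((h₁.tr_iff _ _ _ _).2
      (.single (h₁.S_eq ▸ hr) hi (.inl ⟨c, rfl⟩) (h.restrict (W_subset_netW hi))))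
    ((h₂.tr_iff _ _ _ _).2 (by
      rw [e]
      exact .single (h₂.S_eq ▸ hws) hj (.inr ⟨c, rfl⟩) (h'.restrict (W_subset_netW hj))))
    (fun hcs => by
      rw [h₁.comm_iff hc hax hrec (h₁.S_eq ▸ hr), h₂.comm_iff hc hax hrec (h₂.S_eq ▸ hs)] at hcs
      rcases hcs with ⟨k, hkJ, hkc⟩ | ⟨k, hkJ, hkc⟩
      · exact hk k (.inl hkJ) ((inCommitted_restrict_netW hkJ).1 hkc)
      · exact hk k (.inr hkJ) ((inCommitted_restrict_netW hkJ).1 hkc))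
  -- The target is glued as `s' ▷ r'`: the receiver acts last and may overwrite shared variables, so
  -- its values take precedence.
  rwa [restrict_override_restrict_netW hu.1,
    restrict_override_restrict_netW_of_frameStep (Set.union_comm J₁ J₂ ▸ hw.1) h'.dom_eq
      fun x hx => h'.eq_of_notMem_netW hj hx] at this

open Classical in
theorem Represents.parStep_snd (hc : ∀ i j, i ≠ j → (A i).Compatible (A j))
    (hax : ∀ i, (A i).Axioms) (h₁ : Represents A J₁ T₁) (h₂ : Represents A J₂ T₂)
    (hJ : Disjoint J₁ J₂) {u w u' : PVal X D} {b : Bool} {β : ι → Bool} {δ : Δ} {i : ι}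
    (hu : u ∈ netStates A (J₁ ∪ J₂)) (hi : i ∈ J₁)
    (h : (A i).FrameStep (β i) u (.disc (.bsend δ)) w)
    (h' : ∀ j ∈ J₁ ∪ J₂, j ≠ i → (A j).LocalStep (β j) w (.disc (.brecv δ)) u')
    (hwi : ∀ x ∈ (A i).W, u' x = w x) (hd : u'.dom = netW A (J₁ ∪ J₂))
    (hb : b = true ↔ ∃ k ∈ J₁ ∪ J₂, β k = true) :
    TTSB.ParStep T₁ T₂ b u (.disc (.bsend δ)) u' := by
  have hr := h₁.restrict_mem hu
  have hs := h₂.restrict_mem (Set.union_comm J₁ J₂ ▸ hu)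
  have hw := FrameStep.mem_netStates hc hax h hu
  have hws := h₂.restrict_mem (Set.union_comm J₁ J₂ ▸ hw)
  have hW₂ : netW A J₂ ⊆ u.dom := hu.1.symm ▸ netW_mono Set.subset_union_right
  have hW₁ : netW A J₁ ⊆ u'.dom := hd.symm ▸ netW_mono Set.subset_union_left
  have hW₂' : netW A J₂ ⊆ u'.dom := hd.symm ▸ netW_mono Set.subset_union_right
  -- Although `u'` already includes the reactions inside `J₁`, the other half sees only the effect
  -- of the sender, by `eq_of_brecv`.
  have e : (u.restrict (netW A J₂)).update (u'.restrict (netW A J₁)) =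
      w.restrict (netW A J₂) := by
    rw [← PVal.restrict_self (PVal.update_dom _ _), PVal.restrict_dom_of_subset hW₂]
    refine PVal.restrict_congr fun x hx => ?_
    rw [PVal.update_eq_override (by rwa [PVal.restrict_dom_of_subset hW₂])]
    by_cases hx₁ : x ∈ netW A J₁
    · rw [PVal.override_of_mem (by rwa [PVal.restrict_dom_of_subset hW₁]),
        PVal.restrict_of_mem hx₁]
      obtain ⟨k, hk, hxk⟩ := hx
      exact eq_of_brecv hc hax (fun j hj => h' j (.inl hj)) hwi
        (Set.disjoint_right.1 hJ hk) hx₁ hxk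
    · rw [PVal.override_of_notMem (by rwa [PVal.restrict_dom_of_subset hW₁]),
        PVal.restrict_of_mem hx, h.eq_of_notMem_netW hi hx₁]
  -- The composition computes its bit as a disjunction over the two halves; a half counts as
  -- committed when one of its components moves with a committed transition.
  have hbb : b = (decide (∃ k ∈ J₁, β k = true) || decide (∃ k ∈ J₂, β k = true)) := by
    rw [Bool.eq_iff_iff, hb]
    simp only [Bool.or_eq_true, decide_eq_true_iff, Set.mem_union, or_and_right, exists_or]
  have := TTSB.ParStep.snd (s' := u'.restrict (netW A J₂)) hr hs
    (PVal.compat_restrict_restrict _ _ _)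
    ((h₁.tr_iff (decide (∃ k ∈ J₁, β k = true)) _ _ _).2
      (.snd (β := β) (h₁.S_eq ▸ hr) hi (h.restrict (W_subset_netW hi))
        (fun j hj hji => (h' j (.inl hj) hji).restrict (W_subset_netW hj))
        (fun x hx => by
          rw [PVal.restrict_of_mem (W_subset_netW hi hx),
            PVal.restrict_of_mem (W_subset_netW hi hx), hwi x hx])
        (PVal.restrict_dom_of_subset hW₁) decide_eq_true_iff))
    ((h₂.tr_iff (decide (∃ k ∈ J₂, β k = true)) _ _ _).2 (by
      rw [e]
      exact .rcv (β := β) (h₂.S_eq ▸ hws)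
        (fun j hj => (h' j (.inr hj) (ne_of_mem_of_not_mem hi
          (Set.disjoint_right.1 hJ hj)).symm).restrict (W_subset_netW hj))
        (PVal.restrict_dom_of_subset hW₂') decide_eq_true_iff))
    (PVal.compat_restrict_restrict _ _ _)
  rwa [restrict_override_restrict_netW hu.1, restrict_override_restrict_netW hd, ← hbb] at this

open Classical in
theorem Represents.parStep_rcv (h₁ : Represents A J₁ T₁) (h₂ : Represents A J₂ T₂)
    {u u' : PVal X D} {b : Bool} {β : ι → Bool} {δ : Δ} (hu : u ∈ netStates A (J₁ ∪ J₂))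
    (h' : ∀ j ∈ J₁ ∪ J₂, (A j).LocalStep (β j) u (.disc (.brecv δ)) u')
    (hd : u'.dom = netW A (J₁ ∪ J₂)) (hb : b = true ↔ ∃ k ∈ J₁ ∪ J₂, β k = true) :
    TTSB.ParStep T₁ T₂ b u (.disc (.brecv δ)) u' := by
  have hr := h₁.restrict_mem hu
  have hs := h₂.restrict_mem (Set.union_comm J₁ J₂ ▸ hu)
  have hbb : b = (decide (∃ k ∈ J₁, β k = true) || decide (∃ k ∈ J₂, β k = true)) := by
    rw [Bool.eq_iff_iff, hb]
    simp only [Bool.or_eq_true, decide_eq_true_iff, Set.mem_union, or_and_right, exists_or]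
  have := TTSB.ParStep.rcv hr hs (PVal.compat_restrict_restrict _ _ _)
    ((h₁.tr_iff (decide (∃ k ∈ J₁, β k = true)) _ _ _).2
      (.rcv (β := β) (h₁.S_eq ▸ hr)
        (fun j hj => (h' j (.inl hj)).restrict (W_subset_netW hj))
        (PVal.restrict_dom_of_subset (hd.symm ▸ netW_mono Set.subset_union_left))
        decide_eq_true_iff))
    ((h₂.tr_iff (decide (∃ k ∈ J₂, β k = true)) _ _ _).2
      (.rcv (β := β) (h₂.S_eq ▸ hs)
        (fun j hj => (h' j (.inr hj)).restrict (W_subset_netW hj))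
        (PVal.restrict_dom_of_subset (hd.symm ▸ netW_mono Set.subset_union_right))
        decide_eq_true_iff))
    (PVal.compat_restrict_restrict _ _ _)
  rwa [restrict_override_restrict_netW hu.1, restrict_override_restrict_netW hd, ← hbb] at this

theorem Represents.parStep_time (h₁ : Represents A J₁ T₁) (h₂ : Represents A J₂ T₂)
    {u : PVal X D} {d : ℝ≥0} (hu : u ∈ netStates A (J₁ ∪ J₂))
    (h : ∀ i ∈ J₁ ∪ J₂, (A i).LocalStep false u (.delay d) (u.delay d)) :
    TTSB.ParStep T₁ T₂ false u (.delay d) (u.delay d) := by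
  have hr := h₁.restrict_mem hu
  have hs := h₂.restrict_mem (Set.union_comm J₁ J₂ ▸ hu)
  have := TTSB.ParStep.time hr hs (PVal.compat_restrict_restrict _ _ _)
    ((h₁.tr_iff _ _ _ _).2 (.time (d := d) (h₁.S_eq ▸ hr) fun i hi => by
      rw [PVal.restrict_delay]
      exact (h i (.inl hi)).restrict (W_subset_netW hi)))
    ((h₂.tr_iff _ _ _ _).2 (.time (d := d) (h₂.S_eq ▸ hs) fun i hi => by
      rw [PVal.restrict_delay]
      exact (h i (.inr hi)).restrict (W_subset_netW hi)))
    (by rw [PVal.restrict_delay, PVal.restrict_delay]; exact PVal.compat_restrict_restrict _ _ _)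
  rwa [PVal.restrict_delay, PVal.restrict_delay, restrict_override_restrict_netW hu.1,
    restrict_override_restrict_netW (by rw [PVal.delay_dom, hu.1])] at this

/-- Only the position of the active components matters. For handshakes and outputs the half that
contains the sender plays the role of the first component; delays and broadcast inputs are
symmetric. -/
theorem Represents.parStep_of_netStep (hc : ∀ i j, i ≠ j → (A i).Compatible (A j))
    (hax : ∀ i, (A i).Axioms) (hrec : ∀ i, (A i).Receptive) (h₁ : Represents A J₁ T₁)
    (h₂ : Represents A J₂ T₂) (hJ : Disjoint J₁ J₂) {b u a u'}
    (h : NetStep A (J₁ ∪ J₂) b u a u') :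
    TTSB.ParStep T₁ T₂ b u a u' ∨ TTSB.ParStep T₂ T₁ b u a u' := by
  have hU := Set.union_comm J₁ J₂
  cases h with
  | single hu hi ha h =>
    exact hi.imp (fun hi => h₁.parStep_single h₂ hu hi ha h)
      (fun hi => h₂.parStep_single h₁ (hU ▸ hu) hi ha h)
  | tau hu hi h hk =>
    refine hi.imp (fun hi => ?_) (fun hi => ?_)
    · exact h₁.parStep_tau hc hax hrec h₂ hu h.dom_eq (fun x hx => h.eq_of_notMem_netW hi hx) hk
        (.tau (h₁.S_eq ▸ h₁.restrict_mem hu) hi (h.restrict (W_subset_netW hi))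
          fun k hkJ hkc => hk k (.inl hkJ) ((inCommitted_restrict_netW hkJ).1 hkc))
    · exact h₂.parStep_tau hc hax hrec h₁ (hU ▸ hu) h.dom_eq
        (fun x hx => h.eq_of_notMem_netW hi hx) (hU ▸ hk)
        (.tau (h₂.S_eq ▸ h₂.restrict_mem (hU ▸ hu)) hi (h.restrict (W_subset_netW hi))
          fun k hkJ hkc => hk k (.inr hkJ) ((inCommitted_restrict_netW hkJ).1 hkc))
  | sync hu hi hj hij h h' hk =>
    have hd := h'.dom_eq.trans h.dom_eq
    rcases hi with hi | hi <;> rcases hj with hj | hj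
    · exact .inl (h₁.parStep_tau hc hax hrec h₂ hu hd
        (fun x hx => by rw [h'.eq_of_notMem_netW hj hx, h.eq_of_notMem_netW hi hx]) hk
        (.sync (h₁.S_eq ▸ h₁.restrict_mem hu) hi hj hij (h.restrict (W_subset_netW hi))
          (h'.restrict (W_subset_netW hj))
          fun k hkJ hkc => hk k (.inl hkJ) ((inCommitted_restrict_netW hkJ).1 hkc)))
    · exact .inl (h₁.parStep_sync hc hax hrec h₂ hu hi hj h h' hk)
    · exact .inr (h₂.parStep_sync hc hax hrec h₁ (hU ▸ hu) hi hj h h' (hU ▸ hk))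
    · exact .inr (h₂.parStep_tau hc hax hrec h₁ (hU ▸ hu) hd
        (fun x hx => by rw [h'.eq_of_notMem_netW hj hx, h.eq_of_notMem_netW hi hx]) (hU ▸ hk)
        (.sync (h₂.S_eq ▸ h₂.restrict_mem (hU ▸ hu)) hi hj hij (h.restrict (W_subset_netW hi))
          (h'.restrict (W_subset_netW hj))
          fun k hkJ hkc => hk k (.inr hkJ) ((inCommitted_restrict_netW hkJ).1 hkc)))
  | time hu h => exact .inl (h₁.parStep_time h₂ hu h)
  | snd hu hi h h' hwi hd hb =>
    refine hi.imp (fun hi => h₁.parStep_snd hc hax h₂ hJ hu hi h h' hwi hd hb) (fun hi => ?_)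
    rw [hU] at hu h' hd hb
    exact h₂.parStep_snd hc hax h₁ hJ.symm hu hi h h' hwi hd hb
  | rcv hu h' hd hb => exact .inl (h₁.parStep_rcv h₂ hu h' hd hb)

theorem Represents.par (hc : ∀ i j, i ≠ j → (A i).Compatible (A j))
    (hax : ∀ i, (A i).Axioms) (hrec : ∀ i, (A i).Receptive) (h₁ : Represents A J₁ T₁)
    (h₂ : Represents A J₂ T₂) (hJ : Disjoint J₁ J₂) :
    Represents A (J₁ ∪ J₂) (T₁.par T₂) where
  S_eq := by
    ext v
    constructor
    · rintro ⟨r, hr, s, hs, hrs, rfl⟩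
      exact override_mem_netStates (h₁.S_eq ▸ hr) (h₂.S_eq ▸ hs) hrs
    · exact fun hv => ⟨_, h₁.restrict_mem hv, _, h₂.restrict_mem (Set.union_comm J₁ J₂ ▸ hv),
        PVal.compat_restrict_restrict _ _ _, (restrict_override_restrict_netW hv.1).symm⟩
  tr_iff b v a v' := by
    refine ⟨?_, h₁.parStep_of_netStep hc hax hrec h₂ hJ⟩
    rintro (h | h)
    · exact h₁.netStep_of_parStep hc hax hrec h₂ hJ h
    · rw [Set.union_comm]
      exact h₂.netStep_of_parStep hc hax hrec h₁ hJ.symm h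

end Par

/-! ### Induction over the composition -/

theorem represents_singleton (i : ι) : Represents A {i} (A i).ttsb where
  S_eq := by
    ext v
    constructor
    · intro hv
      refine ⟨by rw [netW_singleton]; exact hv.1, ?_⟩
      rintro _ rfl
      rw [PVal.restrict_self hv.1]
      exact hv
    · intro hv
      have := hv.2 i rfl
      rwa [PVal.restrict_self (by rw [hv.1, netW_singleton])] at this
  tr_iff b v a v' := by
    have hmem : ∀ {v : PVal X D}, v ∈ (A i).states → v ∈ netStates A {i} := by
      intro v hv
      refine ⟨by rw [netW_singleton]; exact hv.1, ?_⟩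
      rintro _ rfl
      rwa [PVal.restrict_self hv.1]
    have hstep : ∀ {b v a v'}, v.dom = (A i).W → v'.dom = (A i).W →
        ((A i).Step b v a v' ↔ (A i).LocalStep b v a v') := by
      intro b v a v' hv hv'
      rw [TA.LocalStep, PVal.restrict_self hv, PVal.restrict_self hv']
    constructor
    · intro h
      have hs := h.source_mem
      have hs' := h.target_mem
      have hl := (hstep hs.1 hs'.1).1 h
      have hf : (A i).FrameStep b v a v' :=
        ⟨hl, fun x hx => by
          rw [PVal.notMem_dom.1 (hs.1.symm ▸ hx : x ∉ v.dom),
            PVal.notMem_dom.1 (hs'.1.symm ▸ hx : x ∉ v'.dom)]⟩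
      cases a with
      | delay d =>
        cases h with
        | time _ _ he =>
          subst he
          exact .time (hmem hs) fun j hj => by obtain rfl := hj; exact hl
      | disc a =>
        cases a with
        | csend c => exact .single (hmem hs) rfl (.inl ⟨c, rfl⟩) hf
        | crecv c => exact .single (hmem hs) rfl (.inr ⟨c, rfl⟩) hf
        | tau =>
          refine .tau (hmem hs) rfl hf ?_
          -- The priority condition is automatic for one automaton, as the bit of its transition
          -- records whether its location is committed.
          rintro _ rfl ⟨k, hk, hkv⟩
          cases h with
          | act _ _ _ hl _ _ hb => exact hb.2 (hl.unique hkv ▸ hk)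
        | bsend δ =>
          exact .snd (β := fun _ => b) (hmem hs) rfl hf (fun j hj hji => absurd hj hji)
            (fun _ _ => rfl) (hmem hs').1 (by simp)
        | brecv δ =>
          refine .rcv (β := fun _ => b) (hmem hs) (fun j hj => ?_) (hmem hs').1 (by simp)
          obtain rfl := hj
          exact hl
    · intro h
      have hv := h.source_mem.1
      have hv' := h.dom_eq
      rw [netW_singleton] at hv hv'
      refine (hstep hv hv').2 ?_
      cases h with
      | single _ hi _ h => obtain rfl := hi; exact h.1
      | tau _ hi h => obtain rfl := hi; exact h.1
      | sync _ hi hj hij => obtain rfl := hi; exact absurd hj.symm hij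
      | time _ h => exact h i rfl
      | @snd j b β _ _ _ _ _ hi h _ hw _ hb =>
        obtain rfl := hi
        have : b = β j := by rw [Bool.eq_iff_iff, hb]; simp
        rw [this]
        exact h.1.congr (fun _ _ => rfl) hw
      | @rcv b β _ _ _ _ h _ hb =>
        have : b = β i := by rw [Bool.eq_iff_iff, hb]; simp
        rw [this]
        exact h i rfl

/-- Stated for an injective selection `f` from a fixed family, so that the first `n + 1` components
in the induction step are again a selection from the same family. Injectivity makes the last
component disjoint from them. -/
theorem represents_parAll (hc : ∀ i j, i ≠ j → (A i).Compatible (A j))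
    (hax : ∀ i, (A i).Axioms) (hrec : ∀ i, (A i).Receptive) :
    ∀ {n : ℕ} (f : Fin (n + 1) → ι), Function.Injective f →
      Represents A (Set.range f) (TTSB.parAll fun i => (A (f i)).ttsb)
  | 0, f, _ => by
    have : Set.range f = {f 0} := by
      ext x
      simp [Fin.exists_fin_one, eq_comm]
    rw [this]
    exact represents_singleton (f 0)
  | n + 1, f, hf => by
    have : Set.range f = Set.range (fun i : Fin (n + 1) => f i.castSucc) ∪ {f (Fin.last _)} := by
      ext x
      simp only [Set.mem_range, Set.mem_union, Fin.exists_fin_succ', Set.mem_singleton_iff]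
      simp only [eq_comm]
    rw [this]
    refine (represents_parAll hc hax hrec _ (hf.comp (Fin.castSucc_injective _))).par hc hax hrec
      (represents_singleton _) ?_
    rw [Set.disjoint_singleton_right]
    rintro ⟨i, hi⟩
    exact absurd (hf hi) (Fin.castSucc_lt_last i).ne

theorem TA.FrameStep.eq_post {B : TA X D Δ C} {b} {a : DAct Δ C} {v v' : PVal X D}
    (h : B.FrameStep b v (.disc a) v')
    (ha : ∀ δ, a ≠ .brecv δ) :
    ∃ l g ρ l', B.tr l g a ρ l' ∧ B.At v l ∧ Holds B.V g v ∧ v' = B.post ρ l' v ∧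
      (b = true ↔ l ∈ B.K) := by
  rcases h.1.disc_cases with ⟨l, g, ρ, l', ht, hl, hg, he, hb⟩ | ⟨δ, hδ, -⟩
  · refine ⟨l, g, ρ, l', ht, hl, hg, funext fun x => ?_, hb⟩
    by_cases hx : x ∈ B.W
    · exact he x hx
    · rw [h.2 x hx, TA.post_of_notMem ht h.1.subset_dom hx]
  · exact absurd hδ (ha δ)

/-! ### Enabledness in the source and in the intermediate valuation -/

section Independence

theorem at_iff_of_frameStep (hc : ∀ i j, i ≠ j → (A i).Compatible (A j)) {i k : ι} (hik : k ≠ i)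
    {b v a w} (h : (A i).FrameStep b v a w) {l : D (A k).loc} :
    (A k).At w l ↔ (A k).At v l := by
  rw [TA.At, TA.At, FrameStep.loc_eq hc hik h]

theorem holds_iff_of_frameStep (hc : ∀ i j, i ≠ j → (A i).Compatible (A j)) {i k : ι}
    (hik : k ≠ i) {b v a w} (h : (A i).FrameStep b v a w) (hd : (A k).W ⊆ v.dom)
    {g : Set (PVal X D)} (hg : NotDependOn (A k).V (A k).E g) :
    Holds (A k).V g w ↔ Holds (A k).V g v :=
  TA.holds_iff_of_notDependOn hg (by rw [h.dom_eq]; exact TA.V_subset_W.trans hd)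
    (TA.V_subset_W.trans hd) fun x hx hE => h.2 x fun hi =>
      hE (Compatible.mem_E (hc k i hik) (TA.V_subset_W hx) hi)

end Independence

/-! ### Folded updates versus successive transitions -/

section Fold

/-- The update functions of a handshake can be performed one after the other, together with the
updates of the locations. -/
theorem update_override_eq_post_post {P Q : TA X D Δ C} (hPQ : P.Compatible Q) {s : PVal X D}
    (hP : P.W ⊆ s.dom) (hQ : Q.W ⊆ s.dom) {ρ l' m h b σ m'}
    (ht' : Q.tr m h b σ m') :
    (Q.apply σ (P.apply ρ s)).update ((P.locVal l').override (Q.locVal m')) =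
      Q.post σ m' (P.post ρ l' s) := by
  have hQ₁ : Q.W ⊆ (P.apply ρ s).dom := by rwa [TA.apply_dom]
  have hQ₂ : Q.W ⊆ (P.post ρ l' s).dom := by rwa [TA.post_dom]
  -- The location of `P` is not a variable in `Q.V`, so `Q` computes the same update whether that
  -- location has already been changed or not.
  have hV : ∀ x ∈ Q.V, P.apply ρ s x = P.post ρ l' s x := fun x hx =>
    (TA.post_of_ne _ _ fun e => hPQ.loc_left (e ▸ hx)).symm
  have hdom : (Q.apply σ (P.apply ρ s)).dom = s.dom := by rw [TA.apply_dom, TA.apply_dom]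
  funext x
  by_cases hx : x = Var.data P.loc
  · subst hx
    have hxP : Var.data P.loc ∈ (P.locVal l' : PVal X D).dom := by
      rw [TA.locVal, PVal.single_dom]
      rfl
    rw [PVal.update_of_mem (by rw [hdom]; exact hP TA.loc_mem_W)
      (by rw [PVal.override_dom]; exact .inl hxP), PVal.override_of_mem hxP, TA.locVal,
      PVal.single_self, TA.post_of_notMem ht' hQ₂, TA.post_loc _ _ hP]
    rintro (h | h)
    · exact hPQ.loc_left h
    · exact hPQ.loc_ne (Var.data.inj h)
  by_cases hx' : x = Var.data Q.loc
  · subst hx'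
    have hxQ : Var.data Q.loc ∈ (Q.locVal m' : PVal X D).dom := by
      rw [TA.locVal, PVal.single_dom]
      rfl
    rw [PVal.update_of_mem (by rw [hdom]; exact hQ TA.loc_mem_W)
      (by rw [PVal.override_dom]; exact .inr hxQ), PVal.override_of_notMem, TA.locVal,
      PVal.single_self, TA.post_loc _ _ hQ₂]
    rw [TA.locVal, PVal.single_dom]
    exact hx
  rw [PVal.update_of_notMem, TA.post_of_ne _ _ hx']
  · by_cases hxQ : x ∈ Q.V
    · rw [TA.apply_of_mem ht' (TA.V_subset_W.trans hQ₁) hxQ,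
        TA.apply_of_mem ht' (TA.V_subset_W.trans hQ₂) hxQ, PVal.restrict_congr hV]
    · rw [TA.apply_of_notMem ht' (TA.V_subset_W.trans hQ₁) hxQ,
        TA.apply_of_notMem ht' (TA.V_subset_W.trans hQ₂) hxQ, TA.post_of_ne _ _ hx]
  · rw [PVal.override_dom, TA.locVal, TA.locVal, PVal.single_dom, PVal.single_dom]
    rintro (h | h)
    · exact hx h
    · exact hx' h

variable {ρ : ι → PVal X D → PVal X D} {l l' : ∀ k, D (A k).loc} {g : ι → Set (PVal X D)}
  {δ : Δ}

theorem foldl_apply_dom (L : List ι) (t : PVal X D) :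
    (L.foldl (fun t j => (A j).apply (ρ j) t) t).dom = t.dom := by
  induction L generalizing t with
  | nil => rfl
  | cons k L ih => rw [List.foldl_cons, ih, TA.apply_dom]

theorem TA.Axioms.apply_eq {B : TA X D Δ C} (hB : B.Axioms) {m h σ m'}
    (ht : B.tr m h (.brecv δ) σ m') {t : PVal X D} (hd : B.W ⊆ t.dom) {x : Var X Y}
    (hx : x ∈ B.V → x ∈ B.E) : B.apply σ t x = t x := by
  by_cases hV : x ∈ B.V
  · rw [← hB.post_eq_of_mem_E ht hd (hx hV), TA.post_of_ne _ _ (TA.ne_loc_of_mem_V hV)]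
  · exact TA.apply_of_notMem ht (TA.V_subset_W.trans hd) hV

theorem foldl_apply_of_notMem (hax : ∀ i, (A i).Axioms) {L : List ι}
    (ht : ∀ k ∈ L, (A k).tr (l k) (g k) (.brecv δ) (ρ k) (l' k)) {t : PVal X D}
    (hd : ∀ k ∈ L, (A k).W ⊆ t.dom) {x : Var X Y} (hx : ∀ k ∈ L, x ∈ (A k).V → x ∈ (A k).E) :
    L.foldl (fun t j => (A j).apply (ρ j) t) t x = t x := by
  induction L generalizing t with
  | nil => rfl
  | cons k L ih =>
    rw [List.forall_mem_cons] at ht hx hd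
    rw [List.foldl_cons, ih ht.2 (by simpa only [TA.apply_dom] using hd.2) hx.2,
      (hax k).apply_eq ht.1 hd.1 hx.1]

/-- Variables of `k` that occur in another receiver are external and are not changed by it. So the
updates before `k` do not alter what `k` reads, those after `k` do not alter what it wrote, and the
order of the fold is irrelevant. -/
theorem foldl_apply_of_mem (hc : ∀ i j, i ≠ j → (A i).Compatible (A j))
    (hax : ∀ i, (A i).Axioms) {L : List ι} (hL : L.Nodup)
    (ht : ∀ k ∈ L, (A k).tr (l k) (g k) (.brecv δ) (ρ k) (l' k)) {t : PVal X D}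
    (hd : ∀ k ∈ L, (A k).W ⊆ t.dom) {k : ι} (hk : k ∈ L) {x : Var X Y} (hx : x ∈ (A k).V) :
    L.foldl (fun t j => (A j).apply (ρ j) t) t x = ρ k (t.restrict (A k).V) x := by
  induction L generalizing t with
  | nil => cases hk
  | cons j L ih =>
    rw [List.forall_mem_cons] at ht hd
    rw [List.nodup_cons] at hL
    have hE : ∀ i ∈ L, ∀ x, x ∈ (A i).V → x ∈ (A j).V → x ∈ (A i).E ∧ x ∈ (A j).E := by
      intro i hi x hxi hxj
      have hij : i ≠ j := ne_of_mem_of_not_mem hi hL.1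
      exact ⟨Compatible.mem_E (hc i j hij) (TA.V_subset_W hxi) (TA.V_subset_W hxj),
        Compatible.mem_E (hc j i hij.symm) (TA.V_subset_W hxj) (TA.V_subset_W hxi)⟩
    have hd' : ∀ i ∈ L, (A i).W ⊆ ((A j).apply (ρ j) t).dom := by
      simpa only [TA.apply_dom] using hd.2
    rw [List.foldl_cons]
    rcases List.mem_cons.1 hk with rfl | hk
    · rw [foldl_apply_of_notMem hax ht.2 hd' fun i hi hxi => (hE i hi x hxi hx).1,
        TA.apply_of_mem ht.1 (TA.V_subset_W.trans hd.1) hx]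
    · rw [ih hL.2 ht.2 hd' hk]
      congr 1
      exact PVal.restrict_congr fun y hy =>
        (hax j).apply_eq ht.1 hd.1 fun hyj => (hE k hk y hy hyj).2

theorem foldr_locVal_of_mem (hc : ∀ i j, i ≠ j → (A i).Compatible (A j)) {L : List ι} {k : ι}
    (hk : k ∈ L) : L.foldr (fun k f => ((A k).locVal (l' k)).override f) PVal.empty
      (Var.data (A k).loc) = some (l' k) := by
  induction L with
  | nil => cases hk
  | cons j L ih =>
    rw [List.foldr_cons]
    by_cases hjk : j = k
    · subst hjk
      exact PVal.override_of_some (PVal.single_self _ _)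
    · rw [PVal.override_of_notMem, ih ((List.mem_cons.1 hk).resolve_left (Ne.symm hjk))]
      rw [TA.locVal, PVal.single_dom]
      exact fun h => (hc j k hjk).loc_ne (Var.data.inj h).symm

theorem foldr_locVal_of_notMem {L : List ι} {x : Var X Y}
    (hx : ∀ k ∈ L, x ≠ Var.data (A k).loc) :
    x ∉ (L.foldr (fun k f => ((A k).locVal (l' k)).override f) PVal.empty).dom := by
  induction L with
  | nil => exact fun h => nomatch h
  | cons j L ih =>
    rw [List.forall_mem_cons] at hx
    rw [List.foldr_cons, PVal.override_dom, TA.locVal, PVal.single_dom]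
    exact fun h => h.elim hx.1 (ih hx.2)

/-- The valuation that is reached by a broadcast from the component `i` to the components in
`L`. -/
noncomputable def bcstTarget (A : ι → TA X D Δ C) (i : ι) (L : List ι)
    (ρ : ι → PVal X D → PVal X D) (l' : ∀ k, D (A k).loc) (s : PVal X D) : PVal X D :=
  (L.foldl (fun t j => (A j).apply (ρ j) t) ((A i).apply (ρ i) s)).update
    ((i :: L).foldr (fun k f => ((A k).locVal (l' k)).override f) PVal.empty)

theorem bcstTarget_dom (i : ι) (L : List ι) (s : PVal X D) :
    (bcstTarget A i L ρ l' s).dom = s.dom := by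
  rw [bcstTarget, PVal.update_dom, foldl_apply_dom, TA.apply_dom]

variable {i : ι} {L : List ι} {s : PVal X D}

/-- The component `k` may be the sender or a bystander. What it shares with a receiver is external
and hence untouched, so only the effect of the sender is visible. -/
theorem bcstTarget_of_notMem (hc : ∀ i j, i ≠ j → (A i).Compatible (A j))
    (hax : ∀ i, (A i).Axioms)
    (ht : ∀ k ∈ L, (A k).tr (l k) (g k) (.brecv δ) (ρ k) (l' k)) (hd : ∀ k, (A k).W ⊆ s.dom)
    {k : ι} (hk : k ∉ L) {x : Var X Y} (hx : x ∈ (A k).W) :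
    bcstTarget A i L ρ l' s x = (A i).post (ρ i) (l' i) s x := by
  have hE : ∀ j ∈ L, x ∈ (A j).W → x ∈ (A j).E := fun j hj hxj =>
    Compatible.mem_E (hc j k (ne_of_mem_of_not_mem hj hk)) hxj hx
  by_cases hxi : x = Var.data (A i).loc
  · subst hxi
    have h := foldr_locVal_of_mem hc (l' := l') (List.mem_cons_self (a := i) (l := L))
    rw [bcstTarget, PVal.update_of_mem, h, TA.post_loc _ _ (hd i)]
    · rw [foldl_apply_dom, TA.apply_dom]
      exact hd i TA.loc_mem_W
    · exact Option.isSome_iff_exists.2 ⟨_, h⟩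
  · rw [bcstTarget, PVal.update_of_notMem, foldl_apply_of_notMem hax ht, TA.post_of_ne _ _ hxi]
    · simpa only [TA.apply_dom] using fun k _ => hd k
    · exact fun j hj hxj => hE j hj (TA.V_subset_W hxj)
    · refine foldr_locVal_of_notMem (List.forall_mem_cons.2 ⟨hxi, fun j hj e => ?_⟩)
      subst e
      exact TA.loc_notMem_E (hE j hj TA.loc_mem_W)

/-- In the fold the location of the sender is still the old one when `k` acts, but it is not a
variable in the `V` of `k`; thus `k` behaves as if the sender had completed its transition. -/
theorem bcstTarget_of_mem (hc : ∀ i j, i ≠ j → (A i).Compatible (A j))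
    (hax : ∀ i, (A i).Axioms) (hL : L.Nodup) (hi : i ∉ L)
    (ht : ∀ k ∈ L, (A k).tr (l k) (g k) (.brecv δ) (ρ k) (l' k)) (hd : ∀ k, (A k).W ⊆ s.dom)
    {k : ι} (hk : k ∈ L) {x : Var X Y} (hx : x ∈ (A k).W) :
    bcstTarget A i L ρ l' s x = (A k).post (ρ k) (l' k) ((A i).post (ρ i) (l' i) s) x := by
  have hki : k ≠ i := ne_of_mem_of_not_mem hk hi
  have hd₁ : ∀ k, (A k).W ⊆ ((A i).apply (ρ i) s).dom := by
    simpa only [TA.apply_dom] using hd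
  have hd₂ : ∀ k, (A k).W ⊆ ((A i).post (ρ i) (l' i) s).dom := by
    simpa only [TA.post_dom] using hd
  rcases hx with hx | rfl
  · rw [bcstTarget, PVal.update_of_notMem, foldl_apply_of_mem hc hax hL ht (fun k _ => hd₁ k) hk hx,
      TA.post_of_mem (ht k hk) (hd₂ k) hx]
    · congr 1
      exact PVal.restrict_congr fun y hy =>
        (TA.post_of_ne _ _ fun e => (hc i k hki.symm).loc_left (e ▸ hy)).symm
    · refine foldr_locVal_of_notMem fun j _ e => ?_
      subst e
      by_cases hjk : j = k
      · subst hjk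
        exact (A j).loc_fresh hx
      · exact (hc j k hjk).loc_left hx
  · have h := foldr_locVal_of_mem hc (l' := l') (List.mem_cons_of_mem i hk)
    rw [bcstTarget, PVal.update_of_mem, h, TA.post_loc _ _ (hd₂ k)]
    · rw [foldl_apply_dom, TA.apply_dom]
      exact hd k TA.loc_mem_W
    · exact Option.isSome_iff_exists.2 ⟨_, h⟩

end Fold

/-! ### Closed network transitions and the rules of `LTS(N)` -/

namespace NTA

variable {n : ℕ} {N : NTA X D Δ C n}

theorem mem_RSlist {δ : Δ} {i j : Fin (n + 1)} {s : PVal X D} :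
    j ∈ N.RSlist δ i s ↔ j ∈ N.RS δ i s := by
  simp [RSlist]

theorem RSlist_nodup {δ : Δ} {i : Fin (n + 1)} {s : PVal X D} : (N.RSlist δ i s).Nodup :=
  (List.nodup_finRange _).filter _

theorem netStates_univ : netStates N.A Set.univ = N.states := by
  have hW : netW N.A Set.univ = ⋃ i, (N.A i).W := by
    ext x
    simp [netW]
  ext v
  rw [netStates, hW]
  refine and_congr_right fun hv => ?_
  simp only [Set.mem_univ, true_implies]
  refine forall_congr' fun i => TA.restrict_mem_states ?_
  rw [hv]
  exact Set.subset_iUnion (fun i => (N.A i).W) i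

theorem subset_dom {s : PVal X D} (hs : s ∈ netStates N.A Set.univ) (i : Fin (n + 1)) :
    (N.A i).W ⊆ s.dom := by
  rw [hs.1]
  exact W_subset_netW (Set.mem_univ i)

/-- Translates between the two forms of priority: a committed component forces a committed
transition, or there is no committed component, or some participant is committed. -/
theorem noCommitted_or_iff {s : PVal X D} {b : Bool} {p : Prop} (hb : b = true ↔ p) :
    (∀ k ∈ Set.univ, (N.A k).InCommitted s → b = true) ↔ N.NoCommitted s ∨ p := by
  rw [← hb]
  constructor
  · intro h
    by_cases hn : N.NoCommitted s
    · exact .inl hn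
    · obtain ⟨k, hk⟩ := not_forall_not.1 hn
      exact .inr (h k trivial hk)
  · rintro (h | h) k - hk
    · exact absurd hk (h k)
    · exact h

/-- The set of receivers is determined before the sender moves, the virtual transitions after it.
Both tests agree because the sender changes neither the location of `j` nor the truth of its input
guards. -/
theorem mem_RS_iff (hax : ∀ i, (N.A i).Axioms) {δ : Δ} {i j : Fin (n + 1)} (hji : j ≠ i)
    {s w : PVal X D} {b a} (hs : s ∈ netStates N.A Set.univ)
    (h : (N.A i).FrameStep b s a w) :
    j ∈ N.RS δ i s ↔ ∃ l g ρ l', (N.A j).tr l g (.brecv δ) ρ l' ∧ (N.A j).At w l ∧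
      Holds (N.A j).V g w := by
  rw [RS, Set.mem_ofPred_eq, and_iff_right hji.symm]
  refine exists_congr fun l => exists_congr fun g => exists_congr fun ρ => exists_congr fun l' =>
    and_congr_right fun ht => ?_
  rw [at_iff_of_frameStep N.compat hji h, holds_iff_of_frameStep N.compat hji h (subset_dom hs j)
    ((hax j).input_guard ht (.inl ⟨δ, rfl⟩))]

/-- The transitions of `NetStep` that remain after hiding all channels. -/
inductive ClosedStep (N : NTA X D Δ C n) : PVal X D → Act Δ C → PVal X D → Prop
  | tau {b s t} : NetStep N.A Set.univ b s (.disc .tau) t → ClosedStep N s (.disc .tau) t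
  | time {b s t d} : NetStep N.A Set.univ b s (.delay d) t → ClosedStep N s (.delay d) t
  | bcst {b s t δ} : NetStep N.A Set.univ b s (.disc (.bsend δ)) t →
      (∀ k ∈ Set.univ, (N.A k).InCommitted s → b = true) → ClosedStep N s (.disc .tau) t

theorem localStep_delay_iff {s : PVal X D} {d : ℝ≥0} (hs : s ∈ netStates N.A Set.univ)
    (ht : s.delay d ∈ netStates N.A Set.univ) :
    (∀ i ∈ Set.univ, (N.A i).LocalStep false s (.delay d) (s.delay d)) ↔
      N.NoCommitted s ∧ ¬ ∃ i l g ρ l', (N.A i).urgent l g .tau ρ l' ∧ (N.A i).At s l ∧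
        Holds (N.A i).V g s := by
  have : ∀ i, (N.A i).LocalStep false s (.delay d) (s.delay d) ↔ ¬ (N.A i).InCommitted s ∧
      ¬ ∃ l g ρ l', (N.A i).urgent l g .tau ρ l' ∧ (N.A i).At s l ∧ Holds (N.A i).V g s := by
    intro i
    constructor
    · intro h
      rw [TA.LocalStep] at h
      generalize (s.delay d).restrict (N.A i).W = s' at h
      cases h with
      | time _ _ _ hn hu =>
        simp only [TA.at_restrict, TA.holds_restrict, TA.inCommitted_restrict] at hn hu
        exact ⟨hn, hu⟩
    · rintro ⟨hn, hu⟩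
      refine .time (hs.2 i trivial) (ht.2 i trivial) (PVal.restrict_delay _ _ _).symm
        (TA.inCommitted_restrict.not.2 hn) ?_
      simpa only [TA.at_restrict, TA.holds_restrict] using hu
  simp only [this, Set.mem_univ, true_implies, forall_and, NoCommitted, not_exists]

open Classical in
theorem closedStep_of_step (hax : ∀ i, (N.A i).Axioms) {s t : PVal X D} {a}
    (hs : s ∈ netStates N.A Set.univ) (ht : t ∈ netStates N.A Set.univ) (h : N.Step s a t) :
    N.ClosedStep s a t := by
  have hd := subset_dom hs
  cases h with
  | @tau _ i l g ρ l' htr hl hg he hk =>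
    subst he
    refine .tau (.tau (b := decide (l ∈ (N.A i).K)) hs (Set.mem_univ i) (TA.frameStep_post htr hl hg
      decide_eq_true_iff (hs.2 i trivial) (ht.2 i trivial)) ?_)
    exact (noCommitted_or_iff decide_eq_true_iff).2 hk
  | @sync _ c i j li gi ρi li' lj gj ρj lj' hij htr hl hg htr' hl' hg' he hk =>
    rw [update_override_eq_post_post (N.compat i j hij) (hd i) (hd j) htr'] at he
    subst he
    have hdw : ∀ k, (N.A k).W ⊆ ((N.A i).post ρi li' s).dom := by
      simpa only [TA.post_dom] using hd
    -- The rule guarantees only that the final state is legal. Within the variables of `i`, the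
    -- receiver changes external ones at most, so the intermediate valuation is legal for `i` too.
    have h := TA.frameStep_post htr hl hg (decide_eq_true_iff (p := li ∈ (N.A i).K))
      (hs.2 i trivial) ((hax i).restrict_mem_states (hdw i) (fun x hx hE =>
        TA.post_of_notMem htr' (hdw j) fun hxj => hE (Compatible.mem_E (N.compat i j hij) hx hxj))
        (ht.2 i trivial))
    have h' := TA.frameStep_post htr' ((at_iff_of_frameStep N.compat hij.symm h).2 hl')
      ((holds_iff_of_frameStep N.compat hij.symm h (hd j)
        ((hax j).input_guard htr' (.inr ⟨c, rfl⟩))).2 hg')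
      (decide_eq_true_iff (p := lj ∈ (N.A j).K))
      (restrict_mem_states_of_frameStep N.compat hax hij.symm h (hs.2 j trivial)) (ht.2 j trivial)
    refine .tau (.sync hs (Set.mem_univ i) (Set.mem_univ j) hij h h' ?_)
    exact (noCommitted_or_iff (by simp only [Bool.or_eq_true, decide_eq_true_iff])).2 hk
  | time he hn hu =>
    subst he
    exact .time (.time hs ((localStep_delay_iff hs ht).2 ⟨hn, hu⟩))
  | @bcst _ δ i l l' g ρ htr hl hg hrs hk he =>
    set L := N.RSlist δ i s with hLdef
    have hL : ∀ {j}, j ∈ L ↔ j ∈ N.RS δ i s := mem_RSlist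
    have hi : i ∉ L := fun h => (hL.1 h).1 rfl
    have htL : ∀ k ∈ L, (N.A k).tr (l k) (g k) (.brecv δ) (ρ k) (l' k) := fun k hk =>
      (hrs k (hL.1 hk)).1
    change t = bcstTarget N.A i L ρ l' s at he
    have hti : ∀ x ∈ (N.A i).W, t x = (N.A i).post (ρ i) (l' i) s x := fun x hx => by
      rw [he, bcstTarget_of_notMem N.compat hax htL hd hi hx]
    -- For `k` that neither sends nor receives, `l k` is arbitrary; the bit must be `false` there,
    -- since virtual transitions are uncommitted.
    let β : Fin (n + 1) → Bool := fun k => decide ((k = i ∨ k ∈ L) ∧ l k ∈ (N.A k).K)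
    have hβi : β i = true ↔ l i ∈ (N.A i).K := by simp [β]
    -- Legality after the move of the sender is read off from `t`, which has the same values on the
    -- variables of `i`.
    have h := TA.frameStep_post htr hl hg hβi (hs.2 i trivial)
      (PVal.restrict_congr hti ▸ ht.2 i trivial)
    have hw := FrameStep.mem_netStates N.compat hax h hs
    refine .bcst (.snd (b := decide (∃ k ∈ Set.univ, β k = true)) hs (Set.mem_univ i) h ?_ hti ht.1
      decide_eq_true_iff) ?_
    · intro j _ hji
      by_cases hj : j ∈ L
      · have htj : ∀ x ∈ (N.A j).W, t x =
            (N.A j).post (ρ j) (l' j) ((N.A i).post (ρ i) (l' i) s) x := fun x hx => by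
          rw [he, bcstTarget_of_mem N.compat hax RSlist_nodup hi htL hd hj hx]
        obtain ⟨hj₁, hj₂, hj₃⟩ := hrs j (hL.1 hj)
        refine (TA.frameStep_post hj₁ ((at_iff_of_frameStep N.compat hji h).2 hj₂)
          ((holds_iff_of_frameStep N.compat hji h (hd j)
            ((hax j).input_guard hj₁ (.inl ⟨δ, rfl⟩))).2 hj₃)
          (by simp [β, hj]) (hw.2 j trivial)
          (PVal.restrict_congr htj ▸ ht.2 j trivial)).1.congr (fun _ _ => rfl) htj
      · have htj : ∀ x ∈ (N.A j).W, t x = (N.A i).post (ρ i) (l' i) s x := fun x hx => by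
          rw [he, bcstTarget_of_notMem N.compat hax htL hd hj hx]
        have hβj : β j = false := by simp [β, hji, hj]
        rw [hβj, TA.LocalStep, PVal.restrict_congr htj]
        refine .virt (hw.2 j trivial) ?_
        simpa only [TA.at_restrict, TA.holds_restrict, ← mem_RS_iff hax hji hs h] using
          hL.not.1 hj
    · refine (noCommitted_or_iff (decide_eq_true_iff.trans ?_)).2 hk
      simp only [Set.mem_univ, true_and, β, decide_eq_true_iff, or_and_right, exists_or,
        exists_eq_left, hL]

open Classical in
-- Each local step is inverted to an edge of the automaton. For a broadcast, the components whose
-- step is an edge are exactly the sender and the members of `RS`, and the target is recovered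
-- variable by variable.
theorem step_of_closedStep (hax : ∀ i, (N.A i).Axioms) {s t : PVal X D} {a}
    (ht : t ∈ netStates N.A Set.univ) (h : N.ClosedStep s a t) :
    N.Step s a t := by
  cases h with
  | tau h =>
    cases h with
    | single _ _ ha => simp at ha
    | tau hs _ h hk =>
      obtain ⟨l, g, ρ, l', htr, hl, hg, he, hb⟩ := h.eq_post (by simp)
      exact .tau htr hl hg he ((noCommitted_or_iff hb).1 hk)
    | @sync i j b b' c _ w _ hs _ _ hij h h' hk =>
      have hd := subset_dom hs
      obtain ⟨l, g, ρ, l', htr, hl, hg, he, hb⟩ := h.eq_post (by simp)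
      obtain ⟨m, g', σ, m', htr', hl', hg', he', hb'⟩ := h'.eq_post (by simp)
      refine .sync hij htr hl hg htr' ((at_iff_of_frameStep N.compat hij.symm h).1 hl')
        ((holds_iff_of_frameStep N.compat hij.symm h (hd j)
          ((hax j).input_guard htr' (.inr ⟨c, rfl⟩))).1 hg') ?_
        ((noCommitted_or_iff (by rw [Bool.or_eq_true, hb, hb'])).1 hk)
      rw [update_override_eq_post_post (N.compat i j hij) (hd i) (hd j) htr', he', he]
  | time h =>
    have hs := h.source_mem
    obtain ⟨-, rfl, hl⟩ := h.delay_cases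
    obtain ⟨hn, hu⟩ := (localStep_delay_iff hs ht).1 hl
    exact .time rfl hn hu
  | @bcst b _ _ δ h hk =>
    cases h with
    | single _ _ ha => simp at ha
    | @snd i _ β _ _ w _ hs _ h h' hwi hdt hb =>
      have hd := subset_dom hs
      obtain ⟨li, gi, ρi, li', htr, hl, hg, he, hbi⟩ := h.eq_post (by simp)
      have key : ∀ k, ∃ (l : D (N.A k).loc) (g : Set (PVal X D)) (ρ : PVal X D → PVal X D)
          (l' : D (N.A k).loc),
          (k = i → (N.A k).tr l g (.bsend δ) ρ l' ∧ (N.A k).At s l ∧ Holds (N.A k).V g s ∧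
            w = (N.A k).post ρ l' s ∧ (β k = true ↔ l ∈ (N.A k).K)) ∧
          (k ∈ N.RS δ i s → (N.A k).tr l g (.brecv δ) ρ l' ∧ (N.A k).At s l ∧
            Holds (N.A k).V g s ∧ (∀ x ∈ (N.A k).W, t x = (N.A k).post ρ l' w x) ∧
            (β k = true ↔ l ∈ (N.A k).K)) := by
        intro k
        by_cases hki : k = i
        · subst hki
          exact ⟨li, gi, ρi, li', fun _ => ⟨htr, hl, hg, he, hbi⟩, fun hk => absurd rfl hk.1⟩
        by_cases hkr : k ∈ N.RS δ i s
        · rcases (h' k trivial hki).disc_cases with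
            ⟨l, g, ρ, l', htr, hl, hg, he, hb⟩ | ⟨δ', hδ, hn, -⟩
          · exact ⟨l, g, ρ, l', fun h => absurd h hki, fun _ => ⟨htr,
              (at_iff_of_frameStep N.compat hki h).1 hl,
              (holds_iff_of_frameStep N.compat hki h (hd k)
                ((hax k).input_guard htr (.inl ⟨δ, rfl⟩))).1 hg, he, hb⟩⟩
          · cases hδ
            exact absurd ((mem_RS_iff hax hki hs h).1 hkr) hn
        -- Dummy data for the components that take no part, whose choice is never inspected.
        · exact ⟨(N.A k).l0, ∅, id, (N.A k).l0, fun h => absurd h hki, fun h => absurd h hkr⟩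
      choose l g ρ l' hsnd hrcv using key
      obtain ⟨htr, hl, hg, he, hbi⟩ := hsnd i rfl
      have hL : ∀ {j}, j ∈ N.RSlist δ i s ↔ j ∈ N.RS δ i s := mem_RSlist
      have hi : i ∉ N.RSlist δ i s := fun h => (hL.1 h).1 rfl
      have htL : ∀ k ∈ N.RSlist δ i s, (N.A k).tr (l k) (g k) (.brecv δ) (ρ k) (l' k) :=
        fun k hk => (hrcv k (hL.1 hk)).1
      have hvirt : ∀ k, k ≠ i → k ∉ N.RS δ i s →
          (∀ x ∈ (N.A k).W, t x = w x) ∧ β k = false := by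
        intro k hki hkr
        rcases (h' k trivial hki).disc_cases with
          ⟨l, g, ρ, l', htr, hl, hg, he, hb⟩ | ⟨δ', hδ, hn, he, hb⟩
        · exact absurd ((mem_RS_iff hax hki hs h).2 ⟨l, g, ρ, l', htr, hl, hg⟩) hkr
        · exact ⟨he, hb⟩
      refine .bcst (l := l) (l' := l') (g := g) (ρ := ρ) (i := i) (δ := δ) htr hl hg
        (fun j hj => ⟨(hrcv j hj).1, (hrcv j hj).2.1, (hrcv j hj).2.2.1⟩)
        ((noCommitted_or_iff (hb.trans ?_)).1 hk) ?_
      · constructor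
        · rintro ⟨k, -, hkβ⟩
          by_cases hki : k = i
          · subst hki
            exact .inl (hbi.1 hkβ)
          by_cases hkr : k ∈ N.RS δ i s
          · exact .inr ⟨k, hkr, (hrcv k hkr).2.2.2.2.1 hkβ⟩
          · rw [(hvirt k hki hkr).2] at hkβ
            cases hkβ
        · rintro (hK | ⟨k, hkr, hK⟩)
          · exact ⟨i, trivial, hbi.2 hK⟩
          · exact ⟨k, trivial, (hrcv k hkr).2.2.2.2.2 hK⟩
      · change t = bcstTarget N.A i (N.RSlist δ i s) ρ l' s
        funext x
        by_cases hx : x ∈ t.dom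
        · obtain ⟨k, -, hxk⟩ := hdt ▸ hx
          by_cases hkr : k ∈ N.RS δ i s
          · rw [bcstTarget_of_mem N.compat hax RSlist_nodup hi htL hd (hL.2 hkr) hxk,
              (hrcv k hkr).2.2.2.1 x hxk, ← he]
          · rw [bcstTarget_of_notMem N.compat hax htL hd (hL.not.2 hkr) hxk, ← he]
            by_cases hki : k = i
            · subst hki
              exact hwi x hxk
            · exact (hvirt k hki hkr).1 x hxk
        · rw [PVal.notMem_dom.1 hx, eq_comm, ← PVal.notMem_dom, bcstTarget_dom, hs.1, ← hdt]
          exact hx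

theorem represents_parAll_ttsb (hax : ∀ i, (N.A i).Axioms) (hrec : ∀ i, (N.A i).Receptive) :
    Represents N.A Set.univ (TTSB.parAll fun i => (N.A i).ttsb) := by
  have := represents_parAll N.compat hax hrec id Function.injective_id
  rwa [Set.range_id] at this

/-- With all channels restricted, only `τ` and delays survive unchanged. For a hidden output, the
condition on `Comm` becomes the condition on committed locations by `Represents.comm_iff`. -/
theorem ttsb_tr_iff (hax : ∀ i, (N.A i).Axioms) (hrec : ∀ i, (N.A i).Receptive)
    {s t : PVal X D} {a} : (N.ttsb.tr true s a t ∨ N.ttsb.tr false s a t) ↔ N.ClosedStep s a t := by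
  have hrep := represents_parAll_ttsb hax hrec
  have hcomm : ∀ {b : Bool} {s : PVal X D}, s ∈ netStates N.A Set.univ →
      (((TTSB.parAll fun i => (N.A i).ttsb).Comm s → b = true) ↔
        ∀ k ∈ Set.univ, (N.A k).InCommitted s → b = true) := by
    intro b s hs
    rw [hrep.comm_iff N.compat hax hrec hs]
    simp
  have hex : (N.ttsb.tr true s a t ∨ N.ttsb.tr false s a t) ↔
      ∃ b, TTSB.RestrictStep (TTSB.parAll fun i => (N.A i).ttsb) Set.univ Set.univ b s a t := by
    rw [Bool.exists_bool, or_comm]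
    rfl
  rw [hex]
  constructor
  · rintro ⟨b, h⟩
    cases h with
    | keep h hB hF =>
      rw [hrep.tr_iff] at h
      match a, h, hB, hF with
      | .delay d, h, _, _ => exact .time h
      | .disc .tau, h, _, _ => exact .tau h
      | .disc (.bsend δ), _, hB, _ => exact absurd rfl (hB δ trivial).1
      | .disc (.brecv δ), _, hB, _ => exact absurd rfl (hB δ trivial).2
      | .disc (.csend c), _, _, hF => exact absurd rfl (hF c trivial).1
      | .disc (.crecv c), _, _, hF => exact absurd rfl (hF c trivial).2
    | hide _ h hc =>
      rw [hrep.tr_iff] at h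
      exact .bcst h ((hcomm h.source_mem).1 hc)
  · intro h
    cases h with
    | tau h => exact ⟨_, .keep ((hrep.tr_iff _ _ _ _).2 h) (by simp) (by simp)⟩
    | time h => exact ⟨_, .keep ((hrep.tr_iff _ _ _ _).2 h) (by simp) (by simp)⟩
    | bcst h hk =>
      exact ⟨_, .hide trivial ((hrep.tr_iff _ _ _ _).2 h) ((hcomm h.source_mem).2 hk)⟩

theorem ttsb_S_eq (hax : ∀ i, (N.A i).Axioms) (hrec : ∀ i, (N.A i).Receptive) :
    N.ttsb.S = N.states :=
  (represents_parAll_ttsb hax hrec).S_eq.trans netStates_univ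

theorem ttsb_s0_eq (N : NTA X D Δ C n) : N.ttsb.s0 = N.s0 := by
  have hv : ∀ i, (N.A i).v0.dom = (N.A i).V := fun i => (N.A i).v0_mem
  have hc : ∀ i j, ((N.A i).v0).Compat (N.A j).v0 := fun i j => by
    rcases eq_or_ne i j with rfl | hij
    · exact PVal.compat_refl _
    · exact (N.compat i j hij).init
  have hl : ∀ i j, ((N.A i).locVal (N.A i).l0).Compat ((N.A j).locVal (N.A j).l0) := fun i j => by
    rcases eq_or_ne i j with rfl | hij
    · exact PVal.compat_refl _
    · rw [PVal.compat_iff]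
      intro x a b ha hb
      obtain rfl := PVal.single_some ha
      exact absurd (Var.data.inj (PVal.single_some hb)) (N.compat i j hij).loc_ne
  have hs0 : N.ttsb.s0 = PVal.mergeAll fun i => (N.A i).v0.override ((N.A i).locVal (N.A i).l0) :=
    TTSB.parAll_s0 _
  have hdom : N.ttsb.s0.dom = N.s0.dom := by
    rw [hs0, s0]
    simp only [PVal.mergeAll_dom, PVal.override_dom, Set.iUnion_union_distrib]
  -- Both merges have the same domain, so it suffices that every value of the componentwise merge
  -- occurs in `N.s0`.
  rw [← PVal.restrict_self (f := N.s0) rfl, ← hdom]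
  refine (PVal.restrict_eq fun x a hx => ?_).symm
  rw [hs0] at hx
  obtain ⟨i, hi⟩ := PVal.exists_of_mergeAll hx
  rw [PVal.override, Option.or_eq_some_iff] at hi
  rcases hi with hi | ⟨-, hi⟩
  · exact PVal.override_of_some (PVal.mergeAll_of_some hc hi)
  · rw [s0, PVal.override_of_notMem]
    · exact PVal.mergeAll_of_some hl hi
    · obtain rfl := PVal.single_some hi
      rw [PVal.mergeAll_dom, Set.mem_iUnion]
      rintro ⟨j, hj⟩
      rw [hv] at hj
      rcases eq_or_ne i j with rfl | hij
      · exact (N.A i).loc_fresh hj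
      · exact (N.compat i j hij).loc_left hj

end NTA

end BroadcastTA

theorem mainTheorem2 {X Y : Type*} {D : Y → Type} {Δ C : Type*} {n : ℕ}
    (N : NTA X D Δ C n)
    (hax : ∀ i, (N.A i).Axioms)
    (hrec : ∀ i, (N.A i).Receptive) :
    Nonempty (LTS.Iso N.lts N.compLts) := by
  -- The isomorphism is the identity on valuations; only the descriptions of the state set differ.
  refine ⟨⟨Equiv.setCongr (NTA.ttsb_S_eq hax hrec).symm, Subtype.ext (NTA.ttsb_s0_eq N).symm,
    fun s a t => ?_⟩⟩
  have hs : s.1 ∈ netStates N.A Set.univ := NTA.netStates_univ.symm.le s.2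
  have ht : t.1 ∈ netStates N.A Set.univ := NTA.netStates_univ.symm.le t.2
  exact Iff.trans ⟨NTA.closedStep_of_step hax hs ht, NTA.step_of_closedStep hax ht⟩
    (NTA.ttsb_tr_iff hax hrec).symm
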